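/- Let $R$ be a commutative ring, $(\mathcal A,d)$ a $\mathbb Z$-graded, graded commutative DG $R$-algebra (unital, $d$ of degree $1$), and $A$ a graded $R$-module, regarded as a complex with zero differential. Let $(f,g,h)$ be a reduction of $\mathcal A$ onto $A$: $f:\mathcal A\to A$ and $g:A\to\mathcal A$ are morphisms of complexes, $h:\mathcal A\to\mathcal A$ is linear of degree $-1$, $fg=1$, $1-gf=dh+hd$ and $hg=fh=hh=0$ (so $A\cong H^*(\mathcal A)$; for instance $A=H^*(\mathcal A)$). **Products on $A$.** Let $\lambda_2(a_1\otimes a_2)=a_1a_2$ and $\lambda_n=\sum_{p=1}^{n-1}(-1)^{p+1}\lambda_2[h\lambda_p\otimes h\lambda_{n-p}]$ with $h\lambda_1:=-\mathrm{id}_{\mathcal A}$ (with the Koszul sign rule, $h\lambda_q$ having degree $1-q$), and let $m_n=f\circ\lambda_n\circ g^{\otimes n}:A^{\otimes n}\to A$ for $n\ge 2$ be the resulting $A_\infty$-products on $A$. **Graph complex.** Let $G$ be a simple graph on the vertices $1,\dots,n$, each edge being oriented $i\to j$ with $i<j$, and let the set $E(G)$ of edges be ordered lexicographically by the pairs $(i,j)$.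 For $s\subset E(G)$ let $[G:s]$ be the graph with all vertices of $G$ and the edges in $s$, let $l(s)$ be the number of its components, ordered by their smallest vertices, and let $e_s$ be the ordered exterior product of the $e_\alpha$, $\alpha\in s$. Put $C_{\mathcal A}(G)=\bigoplus_{s\subset E(G)}e_s\cdot\mathcal A^{\otimes l(s)}$, and define $C_A(G)$ likewise as a graded module. The differential $\delta$ on $C_{\mathcal A}(G)$ sends $e_s\cdot x$ to $\sum_{\alpha\in E(G)\setminus s}e_\alpha e_s\cdot\mu_\alpha(x)$, where $\mu_\alpha:\mathcal A^{\otimes l(s)}\to\mathcal A^{\otimes l(s\cup\alpha)}$ is the homomorphism of graded algebras which multiplies, with Koszul sign, the tensor factors of those components that $\alpha$ joins. Let $(f,g,h)$ also denote the induced maps between $C_{\mathcal A}(G)$ and $C_A(G)$: $f^{\otimes l(s)}$ and $g^{\otimes l(s)}$ on the coefficients of $e_s$, and $h(e_s\cdot x)=(-1)^{|s|}e_s\cdot\sum_{i=1}^{l(s)}\bigl((gf)^{\otimes(i-1)}\otimes h\otimes 1^{\otimes(l(s)-i)}\bigr)(x)$. For $i\ge1$ set $d_i=(-1)^{i-1}f(\delta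 h)^{i-1}\delta g:C_A(G)\to C_A(G)$. **Claim.** Let $n\ge 2$, let $G$ be a tree on $n$ vertices and $t=E(G)$, so that $|t|=n-1$. Then for all homogeneous $a_1,\dots,a_n\in A$ $$d_{n-1}(a_1\otimes\cdots\otimes a_n)=(-1)^{\frac{n(n-1)}2}\,\varepsilon(G)\sum_{\sigma\in\Sigma(G)}(-1)^\sigma\, e_t\cdot (m_n\circ\sigma)(a_1\otimes\cdots\otimes a_n).$$ Here $a_1\otimes\cdots\otimes a_n$ stands for $e_\emptyset\cdot a_1\otimes\cdots\otimes a_n$; $\Sigma(G)$ is the set of all permutations $\sigma$ of $\{1,\dots,n\}$ such that the total order $\sigma(1),\sigma(2),\dots,\sigma(n)$ refines the partial order generated by $i<j$ for every edge $i\to j$ of $G$; $(-1)^\sigma$ is the sign of $\sigma$; $\sigma(a_1\otimes\cdots\otimes a_n)=\pm a_{\sigma(1)}\otimes\cdots\otimes a_{\sigma(n)}$ with the Koszul sign; and $\varepsilon(G)=\pm1$ is the determinant of the $(n-1)\times(n-1)$ matrix whose rows are indexed by the edges $i\to j$ in lexicographic order and whose columns are indexed by the vertices $1,\dots,n-1$,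 with entry $-1$ in column $i$, entry $1$ in column $j$ (when $j\le n-1$), and $0$ elsewhere. -/

import Mathlib

open scoped TensorProduct

noncomputable section

namespace GraphMassey

/-! ### Graded modules, commutative DG algebras, reductions -/

section Graded

variable {R : Type*} [CommRing R] {B : Type*} [AddCommGroup B] [Module R B]

/-- The linear map which multiplies the degree `i` part of a graded module by `(-1)^i`. -/
def gradeInvol (𝒜 : ℤ → Submodule R B) [DirectSum.Decomposition 𝒜] : B →ₗ[R] B :=
  (DirectSum.toModule R ℤ B fun i => ((i.negOnePow : ℤ) : R) • (𝒜 i).subtype) ∘ₗ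
    (DirectSum.decomposeLinearEquiv 𝒜).toLinearMap

/-- The projection of a graded module onto its even part (`e = 0`) or its odd part (`e = 1`). -/
def parityProj (𝒜 : ℤ → Submodule R B) [DirectSum.Decomposition 𝒜] (e : ZMod 2) : B →ₗ[R] B :=
  (DirectSum.toModule R ℤ B fun i => if (i : ZMod 2) = e then (𝒜 i).subtype else 0) ∘ₗ
    (DirectSum.decomposeLinearEquiv 𝒜).toLinearMap

/-- `(f, g, h)` is a reduction (strong deformation retract, with the side conditions) of the
cochain complex `(𝒦, dK)` onto the cochain complex `(ℒ, dL)`. -/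
structure IsReduction {K L : Type*} [AddCommGroup K] [Module R K] [AddCommGroup L] [Module R L]
    (𝒦 : ℤ → Submodule R K) (dK : K →ₗ[R] K) (ℒ : ℤ → Submodule R L) (dL : L →ₗ[R] L)
    (f : K →ₗ[R] L) (g : L →ₗ[R] K) (h : K →ₗ[R] K) : Prop where
  f_mem : ∀ i, ∀ x ∈ 𝒦 i, f x ∈ ℒ i
  g_mem : ∀ i, ∀ x ∈ ℒ i, g x ∈ 𝒦 i
  h_mem : ∀ i, ∀ x ∈ 𝒦 i, h x ∈ 𝒦 (i - 1)
  f_comm : ∀ x, f (dK x) = dL (f x)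
  g_comm : ∀ x, g (dL x) = dK (g x)
  fg : ∀ x, f (g x) = x
  homotopy : ∀ x, x - g (f x) = dK (h x) + h (dK x)
  hg : ∀ x, h (g x) = 0
  fh : ∀ x, f (h x) = 0
  hh : ∀ x, h (h x) = 0

end Graded

/-- `(𝒜, d)` is a graded commutative differential graded algebra (differential of degree `1`). -/
structure IsCDGA {R : Type*} [CommRing R] {B : Type*} [Ring B] [Algebra R B]
    (𝒜 : ℤ → Submodule R B) (d : B →ₗ[R] B) : Prop where
  d_mem : ∀ i, ∀ x ∈ 𝒜 i, d x ∈ 𝒜 (i + 1)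
  d_d : ∀ x, d (d x) = 0
  leibniz : ∀ i, ∀ x ∈ 𝒜 i, ∀ y, d (x * y) = d x * y + i.negOnePow • (x * d y)
  comm : ∀ i j, ∀ x ∈ 𝒜 i, ∀ y ∈ 𝒜 j, x * y = (i * j).negOnePow • (y * x)

/-! ### The transferred `A_∞` products -/

section Products

variable {R : Type*} [CommRing R] {B : Type*} [Ring B] [Algebra R B]
  (𝒜 : ℤ → Submodule R B) [GradedAlgebra 𝒜] (h : B →ₗ[R] B)

/-- The operation `hλ_m` on a list of `m` elements, with `hλ_1 = -id`. -/
def hLam (l : List B) : B :=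
  if l.length ≤ 1 then -l.headD 0
  else h (∑ p : Fin (l.length - 1), (-1 : ℤ) ^ ((p : ℕ) + 2) •
    (hLam ((l.take ((p : ℕ) + 1)).map ⇑(gradeInvol 𝒜 ^ (l.length - ((p : ℕ) + 1) - 1))) *
      hLam (l.drop ((p : ℕ) + 1))))
termination_by l.length
decreasing_by
  all_goals
    have := p.2
    simp only [List.length_map, List.length_take, List.length_drop]
    omega

/-- The operation `λ_m = ∑_{p=1}^{m-1} (-1)^{p+1} λ_2 [hλ_p ⊗ hλ_{m-p}]` on a list of `m ≥ 2`
elements, where `λ_2` is the product. Since `hλ_{m-p}` has degree `1 - (m - p)`, the Koszul rule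
multiplies each of the first `p` arguments `x` by `(-1)^{(m-p-1) deg x}`. -/
def lam (l : List B) : B :=
  ∑ p ∈ Finset.Ico 1 l.length, (-1 : ℤ) ^ (p + 1) •
    (hLam 𝒜 h ((l.take p).map ⇑(gradeInvol 𝒜 ^ (l.length - p - 1))) * hLam 𝒜 h (l.drop p))

/-- `hLam` is determined by `hλ_1 = -id` and `hλ_m = h ∘ λ_m` for `m ≥ 2`. -/
theorem hLam_eq (l : List B) (hl : 2 ≤ l.length) : hLam 𝒜 h l = h (lam 𝒜 h l) := by
  rw [hLam, if_neg (by omega), lam]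
  congr 1
  rw [Finset.sum_Ico_eq_sum_range, ← Fin.sum_univ_eq_sum_range
    (fun k => (-1 : ℤ) ^ (1 + k + 1) • (hLam 𝒜 h ((l.take (1 + k)).map
      ⇑(gradeInvol 𝒜 ^ (l.length - (1 + k) - 1))) * hLam 𝒜 h (l.drop (1 + k))))]
  refine Finset.sum_congr rfl fun p _ => ?_
  rw [show 1 + (p : ℕ) = p + 1 by omega]

theorem hLam_singleton (x : B) : hLam 𝒜 h [x] = -x := by
  rw [hLam]; simp

/-- The `n`-th `A_∞` product `m_n = f ∘ λ_n ∘ g^{⊗ n}` (`n ≥ 2`), on a pure tensor. -/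
def mProd {A : Type*} [AddCommGroup A] [Module R A] (f : B →ₗ[R] A) (g : A →ₗ[R] B) {n : ℕ}
    (a : Fin n → A) : A :=
  f (lam 𝒜 h (List.ofFn fun i => g (a i)))

end Products

/-! ### Koszul signs and tensor products -/

/-- The Koszul sign for rearranging homogeneous elements of degrees `k i`, listed in the order of
`ι`, according to the values of `φ`: the product of `(-1)^{k i * k j}` over all pairs `i < j` with
`φ j < φ i`. -/
def koszulSign {ι κ : Type*} [Fintype ι] [LinearOrder ι] [LinearOrder κ] (φ : ι → κ)
    (k : ι → ℤ) : ℤˣ :=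
  ∏ p ∈ Finset.univ.filter (fun p : ι × ι => p.1 < p.2 ∧ φ p.2 < φ p.1),
    (k p.1 * k p.2).negOnePow

theorem prod_map_update_of_notMem {ι B : Type*} [Monoid B] [DecidableEq ι] (a : ι → B) (i : ι)
    (x : B) (l : List ι) (hi : i ∉ l) :
    (l.map (Function.update a i x)).prod = (l.map a).prod := by
  congr 1
  refine List.map_congr_left fun j hj => ?_
  rw [Function.update_of_ne]
  rintro rfl
  exact hi hj

theorem prod_map_update_add {ι B : Type*} [Ring B] [DecidableEq ι] (a : ι → B) (i : ι)
    (x y : B) (l : List ι) (hl : l.Nodup) (hi : i ∈ l) :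
    (l.map (Function.update a i (x + y))).prod =
      (l.map (Function.update a i x)).prod + (l.map (Function.update a i y)).prod := by
  induction l with
  | nil => simp at hi
  | cons j l ih =>
    rw [List.nodup_cons] at hl
    simp only [List.map_cons, List.prod_cons]
    by_cases hj : j = i
    · subst hj
      simp only [prod_map_update_of_notMem a j _ l hl.1, Function.update_self, add_mul]
    · have hi' : i ∈ l := by
        rcases List.mem_cons.1 hi with h | h
        · exact absurd h.symm hj
        · exact h
      simp only [Function.update_of_ne hj, ih hl.2 hi', mul_add]

theorem prod_map_update_smul {R ι B : Type*} [CommRing R] [Ring B] [Algebra R B] [DecidableEq ι]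
    (a : ι → B) (i : ι) (c : R) (x : B) (l : List ι) (hl : l.Nodup) (hi : i ∈ l) :
    (l.map (Function.update a i (c • x))).prod = c • (l.map (Function.update a i x)).prod := by
  induction l with
  | nil => simp at hi
  | cons j l ih =>
    rw [List.nodup_cons] at hl
    simp only [List.map_cons, List.prod_cons]
    by_cases hj : j = i
    · subst hj
      simp only [prod_map_update_of_notMem a j _ l hl.1, Function.update_self, smul_mul_assoc]
    · have hi' : i ∈ l := by
        rcases List.mem_cons.1 hi with h | h
        · exact absurd h.symm hj
        · exact h
      simp only [Function.update_of_ne hj, ih hl.2 hi', mul_smul_comm]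

/-- The fibre of `φ` over `y`, listed in increasing order. -/
def fibreList {ι κ : Type*} [Fintype ι] [LinearOrder ι] [DecidableEq κ] (φ : ι → κ) (y : κ) :
    List ι :=
  (Finset.univ.filter fun i => φ i = y).sort (· ≤ ·)

theorem mem_fibreList {ι κ : Type*} [Fintype ι] [LinearOrder ι] [DecidableEq κ] (φ : ι → κ)
    (y : κ) (i : ι) : i ∈ fibreList φ y ↔ φ i = y := by
  simp [fibreList]

theorem nodup_fibreList {ι κ : Type*} [Fintype ι] [LinearOrder ι] [DecidableEq κ] (φ : ι → κ)
    (y : κ) : (fibreList φ y).Nodup := by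
  simp [fibreList]

section Tensor

variable {R : Type*} [CommRing R] {B : Type*} [Ring B] [Algebra R B]
  {ι κ : Type*} [Fintype ι] [LinearOrder ι] [LinearOrder κ]

theorem fibre_update (φ : ι → κ) (a : ι → B) (i : ι) (x : B) :
    (fun y => ((fibreList φ y).map (Function.update a i x)).prod) =
      Function.update (fun y => ((fibreList φ y).map a).prod) (φ i)
        ((fibreList φ (φ i)).map (Function.update a i x)).prod := by
  funext y
  by_cases hy : y = φ i
  · subst hy; simp
  · rw [Function.update_of_ne hy]
    exact prod_map_update_of_notMem a i x _ fun hm => hy ((mem_fibreList φ y i).1 hm).symm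

/-- `⊗_i a_i ↦ ⊗_y ∏_{φ i = y} a_i`, the product over each fibre being taken in increasing order,
without signs. -/
def fibreMul (R : Type*) [CommRing R] (B : Type*) [Ring B] [Algebra R B] (φ : ι → κ) :
    (⨂[R] _ : ι, B) →ₗ[R] (⨂[R] _ : κ, B) :=
  PiTensorProduct.lift <| MultilinearMap.mk'
    (fun a => PiTensorProduct.tprod R fun y => ((fibreList φ y).map a).prod)
    (fun a i x y => by
      rw [fibre_update, fibre_update φ a i x, fibre_update φ a i y,
        prod_map_update_add a i x y _ (nodup_fibreList φ _) ((mem_fibreList φ _ i).2 rfl)]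
      exact MultilinearMap.map_update_add _ _ _ _ _)
    (fun a i c x => by
      rw [fibre_update, fibre_update φ a i x,
        prod_map_update_smul a i c x _ (nodup_fibreList φ _) ((mem_fibreList φ _ i).2 rfl)]
      exact MultilinearMap.map_update_smul _ _ _ _ _)

/-- The linear map `⊗_i a_i ↦ koszulSign φ (deg a) • ⊗_i a_i` (for homogeneous `a_i`). The sign
only depends on the parities, so the tensor is split into its parity components. -/
def koszulOp (𝒜 : ℤ → Submodule R B) [GradedAlgebra 𝒜] (φ : ι → κ) :
    (⨂[R] _ : ι, B) →ₗ[R] (⨂[R] _ : ι, B) :=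
  ∑ e : ι → ZMod 2, ((koszulSign φ (fun i => ((e i).val : ℤ)) : ℤ) : R) •
    PiTensorProduct.map fun i => parityProj 𝒜 (e i)

/-- The map of graded algebras `B^{⊗ ι} → B^{⊗ κ}` induced by multiplication along `φ`, with its
Koszul sign. -/
def koszulMul (𝒜 : ℤ → Submodule R B) [GradedAlgebra 𝒜] (φ : ι → κ) :
    (⨂[R] _ : ι, B) →ₗ[R] (⨂[R] _ : κ, B) :=
  fibreMul R B φ ∘ₗ koszulOp 𝒜 φ

/-- The homotopy `∑_i (gf)^{⊗ (i-1)} ⊗ h ⊗ 1^{⊗ (l-i)}` on a tensor power, where `h`, of odd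
degree, produces the Koszul sign when it moves past the factors on its left. -/
def tensorHomotopy {A : Type*} [AddCommGroup A] [Module R A] (𝒜 : ℤ → Submodule R B)
    [GradedAlgebra 𝒜] (f : B →ₗ[R] A) (g : A →ₗ[R] B) (h : B →ₗ[R] B) :
    (⨂[R] _ : ι, B) →ₗ[R] (⨂[R] _ : ι, B) :=
  ∑ i : ι, PiTensorProduct.map fun j =>
    if j < i then g ∘ₗ f ∘ₗ gradeInvol 𝒜 else if j = i then h else LinearMap.id

end Tensor

/-! ### Graphs on `n` ordered vertices -/

section Graph

variable {n : ℕ}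

/-- The edges `i → j` (`i < j`) of `G`, with the lexicographic order. -/
abbrev Edge (G : SimpleGraph (Fin n)) : Type :=
  {p : Fin n ×ₗ Fin n // (ofLex p).1 < (ofLex p).2 ∧ G.Adj (ofLex p).1 (ofLex p).2}

variable {G : SimpleGraph (Fin n)}

/-- The smaller vertex `i` of `i → j`. -/
def Edge.tail (α : Edge G) : Fin n := (ofLex α.1).1

/-- The larger vertex `j` of `i → j`. -/
def Edge.head (α : Edge G) : Fin n := (ofLex α.1).2

instance : Fintype (Edge G) := Fintype.ofFinite _

/-- The graph `[G : s]` with all vertices of `G` and only the edges in `s`. -/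
def subgraphOf (s : Finset (Edge G)) : SimpleGraph (Fin n) :=
  SimpleGraph.fromRel fun i j => ∃ α ∈ s, α.tail = i ∧ α.head = j

/-- The connected components of `[G : s]`, each represented by its smallest vertex, and ordered
by it. -/
abbrev Comp (s : Finset (Edge G)) : Type :=
  {v : Fin n // ∀ w, (subgraphOf s).Reachable v w → v ≤ w}

instance (s : Finset (Edge G)) : Fintype (Comp s) := Fintype.ofFinite _

open Classical in
/-- The connected component of `[G : s]` which contains `v`. -/
def compOf (s : Finset (Edge G)) (v : Fin n) : Comp s :=
  ⟨(Finset.univ.filter fun w => (subgraphOf s).Reachable v w).min'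
      ⟨v, by simp⟩, fun w hw => by
    apply Finset.min'_le
    have hm := Finset.min'_mem (Finset.univ.filter fun w => (subgraphOf s).Reachable v w)
      ⟨v, by simp⟩
    simp only [Finset.mem_filter, Finset.mem_univ, true_and] at hm ⊢
    exact hm.trans hw⟩

/-- The sign in `e_α e_s = ± e_{s ∪ α}`, for `α ∉ s`. -/
def edgeSign (α : Edge G) (s : Finset (Edge G)) : ℤˣ :=
  (-1) ^ (s.filter (· < α)).card

/-- The sign `ε(G)` of a tree `G` on `n` vertices: the determinant of the `(n-1) × (n-1)` matrix
whose rows correspond to the edges `i → j` in lexicographic order, whose columns correspond to all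
vertices but the last one, and which has the entry `-1` at `i` and the entry `1` at `j`. -/
def treeSign (G : SimpleGraph (Fin n)) : ℤ :=
  Matrix.det (Matrix.of fun r c : Fin (n - 1) =>
    (((Finset.univ : Finset (Edge G)).sort (· ≤ ·))[(r : ℕ)]?).elim (0 : ℤ) fun α =>
      if (c : ℕ) = (α.head : ℕ) then 1 else if (c : ℕ) = (α.tail : ℕ) then -1 else 0)

/-- The set `Σ(G)` of permutations `σ` for which the total order `σ(1), σ(2), …, σ(n)` refines the
partial order generated by the edges `i → j`. -/
def linearExtensions (G : SimpleGraph (Fin n)) : Finset (Equiv.Perm (Fin n)) :=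
  open Classical in
  Finset.univ.filter fun σ => ∀ α : Edge G, σ.symm α.tail < σ.symm α.head

end Graph

/-! ### The graph cohomology complex -/

section Complex

variable {R : Type*} [CommRing R] {n : ℕ}

/-- The graph cohomology complex `⨁_{s ⊆ E(G)} e_s · M^{⊗ l(s)}`; the component at `s` of an
element is the coefficient of `e_s`. -/
abbrev GraphComplex (R : Type*) [CommRing R] (G : SimpleGraph (Fin n)) (M : Type*)
    [AddCommGroup M] [Module R M] : Type _ :=
  ∀ s : Finset (Edge G), ⨂[R] _ : Comp s, M

variable (G : SimpleGraph (Fin n)) {B : Type*} [Ring B] [Algebra R B]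
  (𝒜 : ℤ → Submodule R B) [GradedAlgebra 𝒜]

/-- The differential `δ`, the product with `∑_α e_α`: it sends `e_s · x` to the sum over `α ∉ s`
of `e_α e_s` times the image of `x` under the multiplication along the map from the components of
`[G : s]` to those of `[G : s ∪ α]`. -/
def graphDelta : GraphComplex R G B →ₗ[R] GraphComplex R G B :=
  LinearMap.pi fun u => ∑ α ∈ u, ((edgeSign α (u.erase α) : ℤ) : R) •
    (koszulMul 𝒜 (fun c : Comp (u.erase α) => compOf u c.1) ∘ₗ LinearMap.proj (u.erase α))

variable {A : Type*} [AddCommGroup A] [Module R A]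
  (f : B →ₗ[R] A) (g : A →ₗ[R] B) (h : B →ₗ[R] B)

/-- A linear map of degree `0`, applied to every tensor factor of the graph complex. -/
def graphMap {M N : Type*} [AddCommGroup M] [Module R M] [AddCommGroup N] [Module R N]
    (f : M →ₗ[R] N) : GraphComplex R G M →ₗ[R] GraphComplex R G N :=
  LinearMap.pi fun s => PiTensorProduct.map (fun _ => f) ∘ₗ LinearMap.proj s

/-- The homotopy induced by `h` on the graph complex. The sign `(-1)^{|s|}` is the Koszul sign for
moving `h` past `e_s`, as for the internal differential `d (e_s · x) = (-1)^{|s|} e_s · d x`, which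
anticommutes with `δ`. -/
def graphHomotopy : GraphComplex R G B →ₗ[R] GraphComplex R G B :=
  LinearMap.pi fun s => ((-1 : R) ^ s.card) •
    (tensorHomotopy 𝒜 f g h ∘ₗ LinearMap.proj s)

/-- The operator `d_i = (-1)^{i-1} f (δ h)^{i-1} δ g` (`i ≥ 1`), the `i`-th summand of the
differential which the Basic Perturbation Lemma gives on the reduced graph complex. -/
def perturbOp (i : ℕ) : GraphComplex R G A →ₗ[R] GraphComplex R G A :=
  ((-1 : R) ^ (i - 1)) •
    (graphMap G f ∘ₗ ((graphDelta G 𝒜 ∘ₗ graphHomotopy G 𝒜 f g h) ^ (i - 1) :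
      Module.End R (GraphComplex R G B)) ∘ₗ graphDelta G 𝒜 ∘ₗ graphMap G g)

variable {G} in
/-- The element `e_s · x` of the graph complex. -/
def eMul {M : Type*} [AddCommGroup M] [Module R M] (s : Finset (Edge G))
    (x : ⨂[R] _ : Comp s, M) : GraphComplex R G M :=
  Pi.single s x

end Complex

end GraphMassey

end

/-!
The proof computes the iterates `(h δ)^m` on `e_∅ · g a_1 ⊗ ⋯ ⊗ g a_n` in closed form. For a set
`S` of vertices let `Λ(S)` be the signed sum of the `λ_m`, `m = |S|`, over the linear extensions of
`S` (`lamSum`), and let `W(S)` be the same sum with `hλ_m` in place of `λ_m` (`hLamSum`). At a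
spanning forest `s` with `m` edges, the coefficient of `(h δ)^m` is `± ⊗_c W(c)`, where `c` runs
through the components of `[G : s]` (`iterate_homotopy_delta`). One more `δ` turns this, at the
whole tree, into `± Λ({1, …, n})`, and `f` of this is the sum over `Σ(G)`.

The induction step compares two recursions. On the side of the graph complex, `h` kills every
`W(c)`, and `f h = 0`, so that in the coefficient at `s` only the edges in the first component `c`
with at least two vertices survive (`tensorHomotopy_koszulMul`); each of them multiplies the `W` of
the two parts into which it cuts `c`. On the side of the products, cutting a linear extension in
two writes `Λ(c)` as a sum of `± W(D) W(c \ D)` over all lower sets `D` of `c` (`lamSum_eq_sum`).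
These agree because `Λ(S) = 0` whenever `S` falls into two parts not linked by an edge
(`lamSum_eq_zero_of_isSplit`): this is the vanishing of the transferred products on shuffles, and it
follows from the same recursion, since the only two cuts which survive by induction multiply the
same two elements in opposite orders and cancel by graded commutativity. Hence only the cuts along a
single edge contribute (`lamSum_cell`).

The sign of a forest is a product of two factors. One is the determinant of the boundaries of its
edges together with the smallest vertices of its components (`forestSign`), computed in an exterior
algebra; for a tree it is `ε(G)` (`forestSign_univ`). The other has an exponent modulo `2` which is
a sum over pairs of vertices (`forestExp`); its change when two components are joined is determined
pair by pair (`forestExp_join`).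
-/

noncomputable section

namespace GraphMassey

/-! ### Signs with exponents modulo two -/

section Sign

variable (R : Type*) [CommRing R]

/-- The sign `(-1)^x` in `R`, for an exponent `x` modulo `2`. -/
def sgn (x : ZMod 2) : R := if x = 0 then 1 else -1

@[simp] theorem sgn_zero : sgn R 0 = 1 := by simp [sgn]

@[simp] theorem sgn_one : sgn R 1 = -1 := by simp [sgn]

theorem sgn_add (x y : ZMod 2) : sgn R (x + y) = sgn R x * sgn R y := by
  have : ∀ z : ZMod 2, z = 0 ∨ z = 1 := by decide
  have h2 : (1 + 1 : ZMod 2) = 0 := by decide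
  rcases this x with rfl | rfl <;> rcases this y with rfl | rfl <;> simp [h2]

theorem sgn_mul_self (x : ZMod 2) : sgn R x * sgn R x = 1 := by
  rw [← sgn_add, CharTwo.add_self_eq_zero, sgn_zero]

theorem sgn_sum {ι : Type*} (s : Finset ι) (x : ι → ZMod 2) :
    sgn R (∑ i ∈ s, x i) = ∏ i ∈ s, sgn R (x i) := by
  classical
  induction s using Finset.induction_on with
  | empty => simp
  | insert i s hi ih => rw [Finset.sum_insert hi, Finset.prod_insert hi, sgn_add, ih]

theorem sgn_natCast (m : ℕ) : sgn R (m : ZMod 2) = (-1) ^ m := by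
  induction m with
  | zero => simp
  | succ m ih => rw [Nat.cast_succ, sgn_add, ih, sgn_one, pow_succ]

theorem sgn_intCast (i : ℤ) : sgn R (i : ZMod 2) = ((i.negOnePow : ℤ) : R) := by
  rcases Int.even_or_odd i with hi | hi
  · rw [Int.negOnePow_even i hi, (ZMod.intCast_eq_zero_iff_even).2 hi]; simp
  · rw [Int.negOnePow_odd i hi, (ZMod.intCast_eq_one_iff_odd).2 hi]; simp

variable {R}

theorem intCast_val_zmod_two (x : ZMod 2) : (((x.val : ℤ)) : ZMod 2) = x := by simp

end Sign

/-! ### Homogeneous elements -/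

section Graded

variable {R : Type*} [CommRing R] {B : Type*} [AddCommGroup B] [Module R B]
  (𝒜 : ℤ → Submodule R B) [DirectSum.Decomposition 𝒜]

theorem gradeInvol_of_mem {i : ℤ} {x : B} (hx : x ∈ 𝒜 i) :
    gradeInvol 𝒜 x = sgn R (i : ZMod 2) • x := by
  simp only [gradeInvol, LinearMap.comp_apply, LinearEquiv.coe_coe,
    DirectSum.decomposeLinearEquiv_apply]
  rw [DirectSum.decompose_of_mem _ hx]
  erw [DirectSum.toModule_lof]
  simp [sgn_intCast]

theorem gradeInvol_pow_of_mem {i : ℤ} {x : B} (hx : x ∈ 𝒜 i) (q : ℕ) :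
    (gradeInvol 𝒜 ^ q) x = sgn R ((q : ZMod 2) * (i : ZMod 2)) • x := by
  induction q with
  | zero => simp
  | succ q ih =>
    rw [pow_succ', Module.End.mul_apply, ih, map_smul, gradeInvol_of_mem 𝒜 hx, smul_smul,
      ← sgn_add]
    congr 2
    push_cast
    ring

theorem parityProj_of_mem {i : ℤ} {x : B} (hx : x ∈ 𝒜 i) (e : ZMod 2) :
    parityProj 𝒜 e x = if (i : ZMod 2) = e then x else 0 := by
  simp only [parityProj, LinearMap.comp_apply, LinearEquiv.coe_coe,
    DirectSum.decomposeLinearEquiv_apply]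
  rw [DirectSum.decompose_of_mem _ hx]
  erw [DirectSum.toModule_lof]
  split_ifs <;> simp

end Graded

/-! ### Koszul multiplications and homotopies on pure tensors -/

section Tensor

variable {R : Type*} [CommRing R] {B : Type*} [Ring B] [Algebra R B]
  {ι κ : Type*} [Fintype ι] [LinearOrder ι] [LinearOrder κ]

theorem koszulSign_eq_sgn (φ : ι → κ) (k : ι → ℤ) :
    ((koszulSign φ k : ℤ) : R) =
      sgn R (∑ i, ∑ j, if i < j ∧ φ j < φ i then (k i : ZMod 2) * (k j : ZMod 2) else 0) := by
  rw [← Finset.sum_product', ← Finset.sum_filter, sgn_sum, koszulSign, Units.coe_prod,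
    Int.cast_prod]
  refine Finset.prod_congr rfl fun p _ => ?_
  rw [← Int.cast_mul, sgn_intCast]

theorem koszulMul_tprod [inst : DecidableEq κ] (𝒜 : ℤ → Submodule R B) [GradedAlgebra 𝒜] (φ : ι → κ) (k : ι → ℤ)
    (x : ι → B) (hx : ∀ i, x i ∈ 𝒜 (k i)) :
    koszulMul 𝒜 φ (PiTensorProduct.tprod R x) =
      ((koszulSign φ k : ℤ) : R) •
        PiTensorProduct.tprod R fun y => ((fibreList φ y).map x).prod := by
  classical
  obtain rfl : inst = (fun a b => LinearOrder.toDecidableEq a b) := Subsingleton.elim _ _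
  rw [koszulMul, LinearMap.comp_apply, koszulOp, LinearMap.sum_apply,
    Finset.sum_eq_single (fun i => (k i : ZMod 2))]
  · rw [LinearMap.smul_apply, PiTensorProduct.map_tprod, map_smul]
    congr 1
    · rw [koszulSign_eq_sgn, koszulSign_eq_sgn]
      simp only [intCast_val_zmod_two]
    · simp only [parityProj_of_mem 𝒜 (hx _), if_true]
      simp [fibreMul]
  · intro e _ he
    obtain ⟨i, hi⟩ := Function.ne_iff.1 he
    rw [LinearMap.smul_apply, PiTensorProduct.map_tprod,
      (PiTensorProduct.tprod R).map_coord_zero i, smul_zero]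
    rw [parityProj_of_mem 𝒜 (hx i), if_neg (Ne.symm hi)]
  · simp

/-- On a pure tensor all of whose factors but the one at `c` are killed by `h`, only the summand
of the homotopy with `h` at `c` survives. -/
theorem tensorHomotopy_tprod {A : Type*} [AddCommGroup A] [Module R A] (𝒜 : ℤ → Submodule R B)
    [GradedAlgebra 𝒜] (f : B →ₗ[R] A) (g : A →ₗ[R] B) (h : B →ₗ[R] B) (k : ι → ℤ) (x : ι → B)
    (c : ι) (hx : ∀ i, i ≠ c → x i ∈ 𝒜 (k i)) (hh : ∀ i, i ≠ c → h (x i) = 0) :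
    tensorHomotopy 𝒜 f g h (PiTensorProduct.tprod R x) =
      sgn R (∑ i, if i < c then (k i : ZMod 2) else 0) •
        PiTensorProduct.tprod R fun i =>
          if i < c then g (f (x i)) else if i = c then h (x i) else x i := by
  rw [tensorHomotopy, LinearMap.sum_apply, Finset.sum_eq_single c]
  · rw [PiTensorProduct.map_tprod, sgn_sum, ← MultilinearMap.map_smul_univ]
    congr 1
    funext i
    by_cases hi : i < c
    · simp [hi, gradeInvol_of_mem 𝒜 (hx i hi.ne)]
    · by_cases hc : i = c <;> simp [hi, hc]
  · intro b _ hb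
    rw [PiTensorProduct.map_tprod, (PiTensorProduct.tprod R).map_coord_zero b]
    simp [hh b hb]
  · simp

end Tensor

/-! ### The transferred operations on homogeneous elements -/

section Lists

variable {R : Type*} [CommRing R] {B : Type*} [Ring B] [Algebra R B]
  (𝒜 : ℤ → Submodule R B) [GradedAlgebra 𝒜] (h : B →ₗ[R] B)

/-- `hλ_m` is multilinear: scalars can be pulled out of all arguments. -/
theorem hLam_map_smul {V : Type*} (l : List V) (hl : l ≠ []) (c : V → R) (x : V → B) :
    hLam 𝒜 h (l.map fun v => c v • x v) = (l.map c).prod • hLam 𝒜 h (l.map x) := by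
  induction hm : l.length using Nat.strong_induction_on generalizing l x with
  | _ m ih =>
    subst hm
    rcases Nat.lt_or_ge l.length 2 with h2 | h2
    · have : l.length = 1 := by
        have := List.length_pos_iff.2 hl
        omega
      obtain ⟨v, rfl⟩ := List.length_eq_one_iff.1 this
      simp [hLam_singleton]
    · rw [hLam_eq _ _ _ (by simpa using h2), hLam_eq _ _ _ (by simpa using h2), ← map_smul]
      congr 1
      rw [lam, lam, Finset.smul_sum]
      simp only [List.length_map, ← List.map_take, ← List.map_drop, List.map_map]
      refine Finset.sum_congr rfl fun p hp => ?_
      rw [Finset.mem_Ico] at hp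
      have e : (⇑(gradeInvol 𝒜 ^ (l.length - p - 1)) ∘ fun v => c v • x v) =
          fun v => c v • (⇑(gradeInvol 𝒜 ^ (l.length - p - 1)) ∘ x) v := by
        funext v; simp
      rw [e, ih _ _ (l.take p) _ _ rfl, ih _ _ (l.drop p) _ _ rfl, smul_mul_smul_comm,
        smul_comm ((-1 : ℤ) ^ (p + 1)), ← List.prod_append, ← List.map_append,
        List.take_append_drop]
      all_goals first
        | (rw [← List.length_pos_iff]; simp only [List.length_take, List.length_drop]; omega)
        | (simp only [List.length_take, List.length_drop]; omega)

variable {V : Type*} (x : V → B) (k : V → ℤ) (hx : ∀ v, x v ∈ 𝒜 (k v))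

theorem sgn_list_sum (l : List (ZMod 2)) : sgn R l.sum = (l.map (sgn R)).prod := by
  induction l with
  | nil => simp
  | cons a l ih => simp [sgn_add, ih]

include hx in
/-- The recursion for `λ_m` on homogeneous elements, with explicit Koszul signs. -/
theorem lam_map (l : List V) :
    lam 𝒜 h (l.map x) = ∑ p ∈ Finset.Ico 1 l.length,
      sgn R ((p : ZMod 2) + 1 + ((l.drop p).length + 1) *
          ((l.take p).map fun v => (k v : ZMod 2)).sum) •
        (hLam 𝒜 h ((l.take p).map x) * hLam 𝒜 h ((l.drop p).map x)) := by
  rw [lam, List.length_map]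
  refine Finset.sum_congr rfl fun p hp => ?_
  rw [Finset.mem_Ico] at hp
  have e : (⇑(gradeInvol 𝒜 ^ (l.length - p - 1)) ∘ x) =
      fun v => sgn R (((l.length - p - 1 : ℕ) : ZMod 2) * (k v : ZMod 2)) • x v := by
    funext v
    exact gradeInvol_pow_of_mem 𝒜 (hx v) _
  rw [← List.map_take, ← List.map_drop, List.map_map, e, hLam_map_smul, smul_mul_assoc,
    ← Int.cast_smul_eq_zsmul R, smul_smul]
  · congr 1
    have e2 : ((l.length - p - 1 : ℕ) : ZMod 2) = ((l.drop p).length + 1 : ZMod 2) := by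
      obtain ⟨q, hq⟩ : ∃ q, l.length = p + (q + 1) := ⟨l.length - p - 1, by omega⟩
      rw [List.length_drop, hq]
      simp only [Nat.add_sub_cancel_left, Nat.add_sub_cancel]
      push_cast
      rw [add_assoc, CharTwo.add_self_eq_zero, add_zero]
    rw [e2, sgn_add]
    congr 1
    · rw [← Nat.cast_succ, sgn_natCast]
      push_cast
      rfl
    · rw [← List.sum_map_mul_left, sgn_list_sum, List.map_map]
      rfl
  · rw [← List.length_pos_iff, List.length_take]
    omega

include hx in
theorem hLam_map_mem (hh : ∀ i, ∀ y ∈ 𝒜 i, h y ∈ 𝒜 (i - 1)) (l : List V) (hl : l ≠ []) :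
    hLam 𝒜 h (l.map x) ∈ 𝒜 ((l.map k).sum + 1 - l.length) := by
  induction hm : l.length using Nat.strong_induction_on generalizing l with
  | _ m ih =>
    subst hm
    rcases Nat.lt_or_ge l.length 2 with h2 | h2
    · have : l.length = 1 := by
        have := List.length_pos_iff.2 hl
        omega
      obtain ⟨v, rfl⟩ := List.length_eq_one_iff.1 this
      simpa [hLam_singleton] using hx v
    · rw [hLam_eq _ _ _ (by simpa using h2), lam_map 𝒜 h x k hx]
      have : (l.map k).sum + 1 - (l.length : ℤ) = ((l.map k).sum + 2 - l.length) - 1 := by ring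
      rw [this]
      refine hh _ _ (Submodule.sum_mem _ fun p hp => Submodule.smul_mem _ _ ?_)
      rw [Finset.mem_Ico] at hp
      have h1 := ih _ (by simp only [List.length_take]; omega) (l.take p)
        (by rw [← List.length_pos_iff, List.length_take]; omega) rfl
      have h3 := ih _ (by simp only [List.length_drop]; omega) (l.drop p)
        (by rw [← List.length_pos_iff, List.length_drop]; omega) rfl
      have h4 := SetLike.GradedMul.mul_mem h1 h3
      convert h4 using 2
      conv_lhs => rw [← List.take_append_drop p l]
      rw [List.map_append, List.sum_append, List.length_append]
      push_cast
      ring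

end Lists

/-! ### Sums over the linear extensions of a relation -/

section Extensions

variable {V : Type*} [LinearOrder V]

/-- The exponent of the sign of a rearrangement of elements of degrees `k v`: every pair listed
out of order contributes `1` (sign of the permutation) and `k v * k w` (Koszul sign). -/
def listInv (k : V → ℤ) : List V → ZMod 2
  | [] => 0
  | v :: l => (l.map fun w => if w < v then 1 + (k v : ZMod 2) * (k w : ZMod 2) else 0).sum +
      listInv k l

/-- The contribution to `listInv` of the pairs with first entry in `S` and second entry in `T`. -/
def crossInv (k : V → ℤ) (S T : Finset V) : ZMod 2 :=
  ∑ v ∈ S, ∑ w ∈ T, if w < v then 1 + (k v : ZMod 2) * (k w : ZMod 2) else 0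

omit [LinearOrder V] in
theorem list_sum_map_of_coe_eq {M : Type*} [AddCommMonoid M] {l : List V} {S : Finset V}
    (hl : (l : Multiset V) = S.val) (F : V → M) : (l.map F).sum = ∑ v ∈ S, F v := by
  rw [Finset.sum, ← hl, Multiset.map_coe, Multiset.sum_coe]

theorem listInv_append (k : V → ℤ) {l₁ l₂ : List V} {S T : Finset V}
    (h₁ : (l₁ : Multiset V) = S.val) (h₂ : (l₂ : Multiset V) = T.val) :
    listInv k (l₁ ++ l₂) = listInv k l₁ + listInv k l₂ + crossInv k S T := by
  rw [crossInv, ← list_sum_map_of_coe_eq h₁]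
  simp only [← list_sum_map_of_coe_eq h₂]
  clear h₁
  induction l₁ with
  | nil => simp [listInv]
  | cons v l ih =>
    simp only [List.cons_append, listInv, ih, List.map_append, List.sum_append, List.map_cons,
      List.sum_cons]
    abel

theorem crossInv_add_crossInv (k : V → ℤ) {S T : Finset V} (hST : Disjoint S T) :
    crossInv k S T + crossInv k T S =
      S.card * T.card + (∑ v ∈ S, (k v : ZMod 2)) * ∑ v ∈ T, (k v : ZMod 2) := by
  have e : crossInv k T S =
      ∑ v ∈ S, ∑ w ∈ T, if v < w then 1 + (k w : ZMod 2) * (k v : ZMod 2) else 0 := by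
    rw [crossInv, Finset.sum_comm]
  rw [e, crossInv, ← Finset.sum_add_distrib, Finset.sum_mul_sum]
  have e3 : ((S.card : ZMod 2) * T.card) = ∑ v ∈ S, ∑ w ∈ T, (1 : ZMod 2) := by simp
  rw [e3, ← Finset.sum_add_distrib]
  refine Finset.sum_congr rfl fun v hv => ?_
  rw [← Finset.sum_add_distrib, ← Finset.sum_add_distrib]
  refine Finset.sum_congr rfl fun w hw => ?_
  rcases lt_trichotomy v w with hvw | rfl | hvw
  · simp [hvw, hvw.not_gt, mul_comm]
  · exact absurd hw (Finset.disjoint_left.1 hST hv)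
  · simp [hvw, hvw.not_gt]

open Classical in
/-- The linear extensions of the relation `rel` on the finite set `S`: the lists of the elements
of `S` in which no `w` with `rel w v` comes after `v`. -/
def linExts (rel : V → V → Prop) (S : Finset V) : Finset (List V) :=
  S.val.lists.toFinset.filter fun l => l.Pairwise fun v w => ¬ rel w v

theorem mem_linExts {rel : V → V → Prop} {S : Finset V} {l : List V} :
    l ∈ linExts rel S ↔ (l : Multiset V) = S.val ∧ l.Pairwise fun v w => ¬ rel w v := by
  simp only [linExts, Finset.mem_filter, Multiset.mem_toFinset, Multiset.mem_lists_iff]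
  rw [eq_comm]
  rfl

theorem length_of_mem_linExts {rel : V → V → Prop} {S : Finset V} {l : List V}
    (hl : l ∈ linExts rel S) : l.length = S.card := by
  rw [← Multiset.coe_card, (mem_linExts.1 hl).1]; rfl

open Classical in
/-- The nonempty proper subsets of `S` which are closed downwards for `rel`. -/
def lowerParts (rel : V → V → Prop) (S : Finset V) : Finset (Finset V) :=
  S.powerset.filter fun D => D.Nonempty ∧ (S \ D).Nonempty ∧ ∀ v ∈ D, ∀ w ∈ S \ D, ¬ rel w v

theorem mem_lowerParts {rel : V → V → Prop} {S D : Finset V} :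
    D ∈ lowerParts rel S ↔
      D ⊆ S ∧ D.Nonempty ∧ (S \ D).Nonempty ∧ ∀ v ∈ D, ∀ w ∈ S \ D, ¬ rel w v := by
  simp only [lowerParts, Finset.mem_filter, Finset.mem_powerset]

/-- Cutting a linear extension of `S` in two is the same as choosing a lower part `D` of `S` and
linear extensions of `D` and `S \ D`. -/
theorem sum_linExts_cut {M : Type*} [AddCommMonoid M] (rel : V → V → Prop) (S : Finset V)
    (F : List V → List V → M) :
    ∑ l ∈ linExts rel S, ∑ p ∈ Finset.Ico 1 l.length, F (l.take p) (l.drop p) =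
      ∑ D ∈ lowerParts rel S, ∑ l₁ ∈ linExts rel D, ∑ l₂ ∈ linExts rel (S \ D), F l₁ l₂ := by
  simp only [← Finset.sum_product', Finset.sum_sigma']
  refine Finset.sum_bij'
    (fun q _ => ⟨(q.1.take q.2).toFinset, (q.1.take q.2, q.1.drop q.2)⟩)
    (fun q _ => ⟨q.2.1 ++ q.2.2, q.2.1.length⟩) ?_ ?_ ?_ ?_ ?_
  · rintro ⟨l, p⟩ hq
    simp only [Finset.mem_sigma, Finset.mem_Ico, mem_linExts] at hq
    obtain ⟨⟨hl, hpw⟩, hp1, hp2⟩ := hq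
    have hnd : l.Nodup := by rw [← Multiset.coe_nodup, hl]; exact S.nodup
    have hsplit := List.take_append_drop p l
    rw [← hsplit] at hpw hnd
    rw [List.pairwise_append] at hpw
    rw [List.nodup_append'] at hnd
    obtain ⟨hn1, hn2, hdis⟩ := hnd
    have hmem : ∀ v, v ∈ S ↔ v ∈ l.take p ∨ v ∈ l.drop p := by
      intro v
      rw [← Finset.mem_val, ← hl, Multiset.mem_coe]
      conv_lhs => rw [← hsplit, List.mem_append]
    have hS1 : ((l.take p : List V) : Multiset V) = (l.take p).toFinset.val := by
      rw [List.toFinset_val, hn1.dedup]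
    have hSd : S \ (l.take p).toFinset = (l.drop p).toFinset := by
      ext v
      simp only [Finset.mem_sdiff, hmem, List.mem_toFinset]
      constructor
      · rintro ⟨h1 | h1, h2⟩
        · exact absurd h1 h2
        · exact h1
      · exact fun h1 => ⟨Or.inr h1, fun h2 => hdis h2 h1⟩
    have hS2 : ((l.drop p : List V) : Multiset V) = (S \ (l.take p).toFinset).val := by
      rw [hSd, List.toFinset_val, hn2.dedup]
    simp only [Finset.mem_sigma, Finset.mem_product, mem_linExts, mem_lowerParts]
    refine ⟨⟨?_, ?_, ?_, ?_⟩, ⟨hS1, hpw.1⟩, hS2, hpw.2.1⟩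
    · intro v hv
      exact (hmem v).2 (Or.inl (List.mem_toFinset.1 hv))
    · rw [List.toFinset_nonempty_iff, ← List.length_pos_iff, List.length_take]; omega
    · rw [hSd, List.toFinset_nonempty_iff, ← List.length_pos_iff, List.length_drop]; omega
    · intro v hv w hw
      rw [hSd] at hw
      exact hpw.2.2 v (List.mem_toFinset.1 hv) w (List.mem_toFinset.1 hw)
  · rintro ⟨D, l₁, l₂⟩ hq
    simp only [Finset.mem_sigma, Finset.mem_product, mem_linExts, mem_lowerParts] at hq
    obtain ⟨⟨hDS, hD, hD', hlow⟩, ⟨h1, hp1⟩, h2, hp2⟩ := hq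
    have hm1 : ∀ v, v ∈ l₁ ↔ v ∈ D := fun v => by
      rw [← Multiset.mem_coe, h1, Finset.mem_val]
    have hm2 : ∀ v, v ∈ l₂ ↔ v ∈ S \ D := fun v => by
      rw [← Multiset.mem_coe, h2, Finset.mem_val]
    simp only [Finset.mem_sigma, Finset.mem_Ico, mem_linExts, List.length_append]
    refine ⟨⟨?_, ?_⟩, ?_, ?_⟩
    · rw [← Multiset.coe_add, h1, h2, ← Finset.disjUnion_val D (S \ D) Finset.disjoint_sdiff]
      congr 1
      rw [Finset.disjUnion_eq_union, Finset.union_sdiff_of_subset hDS]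
    · rw [List.pairwise_append]
      exact ⟨hp1, hp2, fun v hv w hw => hlow v ((hm1 v).1 hv) w ((hm2 w).1 hw)⟩
    · obtain ⟨v, hv⟩ := hD
      exact List.length_pos_of_mem ((hm1 v).2 hv)
    · obtain ⟨v, hv⟩ := hD'
      have := List.length_pos_of_mem ((hm2 v).2 hv)
      omega
  · rintro ⟨l, p⟩ hq
    simp only [Finset.mem_sigma, Finset.mem_Ico] at hq
    simp only [List.take_append_drop, List.length_take, Nat.min_eq_left hq.2.2.le]
  · rintro ⟨D, l₁, l₂⟩ hq
    simp only [Finset.mem_sigma, Finset.mem_product, mem_linExts] at hq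
    have : l₁.toFinset = D := by
      ext v; rw [List.mem_toFinset, ← Multiset.mem_coe, hq.2.1.1, Finset.mem_val]
    simp [this]
  · rintro ⟨l, p⟩ _
    rfl

end Extensions

/-! ### Products summed over linear extensions -/

section SumProducts

variable {R : Type*} [CommRing R] {B : Type*} [Ring B] [Algebra R B]
  (𝒜 : ℤ → Submodule R B) [GradedAlgebra 𝒜] (h : B →ₗ[R] B)
  {V : Type*} [LinearOrder V] (rel : V → V → Prop) (x : V → B) (k : V → ℤ)

/-- The signed sum of `λ_m` over the linear extensions of `S`, where `m = |S|`. -/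
def lamSum (S : Finset V) : B :=
  ∑ l ∈ linExts rel S, sgn R (listInv k l) • lam 𝒜 h (l.map x)

/-- The signed sum of `hλ_m` over the linear extensions of `S`, where `m = |S|` and
`hλ_1 = -id`. -/
def hLamSum (S : Finset V) : B :=
  ∑ l ∈ linExts rel S, sgn R (listInv k l) • hLam 𝒜 h (l.map x)

/-- The exponent of the sign of the summand of `λ_m` which multiplies the operation on the
arguments from `S` by the operation on the arguments from `T`. -/
def cutExp (S T : Finset V) : ZMod 2 :=
  S.card + 1 + (T.card + 1) * (∑ v ∈ S, (k v : ZMod 2)) + crossInv k S T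

/-- The part of `lamSum` of `S ∪ T` in which the arguments from `S` precede those from `T` and
the outermost product separates the two sets. -/
def cutProd (S T : Finset V) : B :=
  sgn R (cutExp k S T) • (hLamSum 𝒜 h rel x k S * hLamSum 𝒜 h rel x k T)

theorem hLamSum_singleton (v : V) : hLamSum 𝒜 h rel x k {v} = -x v := by
  have : linExts rel {v} = {[v]} := by
    ext l
    rw [mem_linExts, Finset.mem_singleton, Finset.singleton_val, Multiset.coe_eq_singleton]
    constructor
    · exact fun H => H.1
    · rintro rfl
      exact ⟨rfl, List.pairwise_singleton _ _⟩
  simp [hLamSum, this, listInv, hLam_singleton]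

theorem hLamSum_eq {S : Finset V} (hS : 2 ≤ S.card) :
    hLamSum 𝒜 h rel x k S = h (lamSum 𝒜 h rel x k S) := by
  rw [hLamSum, lamSum, map_sum]
  refine Finset.sum_congr rfl fun l hl => ?_
  rw [map_smul, hLam_eq]
  rwa [List.length_map, length_of_mem_linExts hl]

variable (hx : ∀ v, x v ∈ 𝒜 (k v))

include hx in
theorem hLamSum_mem (hh : ∀ i, ∀ y ∈ 𝒜 i, h y ∈ 𝒜 (i - 1)) {S : Finset V} (hS : S.Nonempty) :
    hLamSum 𝒜 h rel x k S ∈ 𝒜 ((∑ v ∈ S, k v) + 1 - S.card) := by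
  refine Submodule.sum_mem _ fun l hl => Submodule.smul_mem _ _ ?_
  rw [← list_sum_map_of_coe_eq (mem_linExts.1 hl).1, ← length_of_mem_linExts hl]
  refine hLam_map_mem 𝒜 h x k hx hh l ?_
  rintro rfl
  exact hS.card_ne_zero (length_of_mem_linExts hl).symm

include hx in
/-- The recursion for the products summed over linear extensions. -/
theorem lamSum_eq_sum (S : Finset V) :
    lamSum 𝒜 h rel x k S = ∑ D ∈ lowerParts rel S, cutProd 𝒜 h rel x k D (S \ D) := by
  have e : lamSum 𝒜 h rel x k S = ∑ l ∈ linExts rel S, ∑ p ∈ Finset.Ico 1 l.length,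
      sgn R (listInv k (l.take p ++ l.drop p) + (((l.take p).length : ZMod 2) + 1 +
        ((l.drop p).length + 1) * ((l.take p).map fun v => (k v : ZMod 2)).sum)) •
        (hLam 𝒜 h ((l.take p).map x) * hLam 𝒜 h ((l.drop p).map x)) := by
    refine Finset.sum_congr rfl fun l _ => ?_
    rw [lam_map 𝒜 h x k hx, Finset.smul_sum]
    refine Finset.sum_congr rfl fun p hp => ?_
    rw [Finset.mem_Ico] at hp
    rw [smul_smul, ← sgn_add, List.take_append_drop, List.length_take, Nat.min_eq_left hp.2.le]
  rw [e, sum_linExts_cut rel S fun l₁ l₂ => sgn R (listInv k (l₁ ++ l₂) +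
    ((l₁.length : ZMod 2) + 1 + (l₂.length + 1) * (l₁.map fun v => (k v : ZMod 2)).sum)) •
      (hLam 𝒜 h (l₁.map x) * hLam 𝒜 h (l₂.map x))]
  refine Finset.sum_congr rfl fun D _ => ?_
  rw [cutProd, hLamSum, hLamSum, Finset.sum_mul_sum, Finset.smul_sum]
  refine Finset.sum_congr rfl fun l₁ h₁ => ?_
  rw [Finset.smul_sum]
  refine Finset.sum_congr rfl fun l₂ h₂ => ?_
  rw [smul_mul_smul_comm, smul_smul, ← sgn_add, ← sgn_add, length_of_mem_linExts h₁,
    length_of_mem_linExts h₂, list_sum_map_of_coe_eq (mem_linExts.1 h₁).1,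
    listInv_append k (mem_linExts.1 h₁).1 (mem_linExts.1 h₂).1, cutExp]
  congr 2
  ring

variable (hh : ∀ i, ∀ y ∈ 𝒜 i, h y ∈ 𝒜 (i - 1))
  (hcomm : ∀ i j, ∀ y ∈ 𝒜 i, ∀ z ∈ 𝒜 j, y * z = (i * j).negOnePow • (z * y))

include hx hh hcomm in
/-- Graded commutativity makes the two orders of a pair of blocks cancel. -/
theorem cutProd_swap {S T : Finset V} (hS : S.Nonempty) (hT : T.Nonempty) (hST : Disjoint S T) :
    cutProd 𝒜 h rel x k S T = -cutProd 𝒜 h rel x k T S := by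
  rw [cutProd, cutProd, hcomm _ _ _ (hLamSum_mem 𝒜 h rel x k hx hh hS) _
    (hLamSum_mem 𝒜 h rel x k hx hh hT), Units.smul_def, ← Int.cast_smul_eq_zsmul R, ← sgn_intCast,
    smul_smul, ← sgn_add, ← neg_one_smul R, smul_smul, ← sgn_one R, ← sgn_add]
  congr 2
  have hc := crossInv_add_crossInv k hST
  have hc' : crossInv k S T = crossInv k T S + (S.card * T.card +
      (∑ v ∈ S, (k v : ZMod 2)) * ∑ v ∈ T, (k v : ZMod 2)) := by
    rw [← hc, add_comm (crossInv k S T), ← add_assoc, CharTwo.add_self_eq_zero, zero_add]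
  rw [cutExp, cutExp, hc']
  push_cast
  generalize (∑ v ∈ S, (k v : ZMod 2)) = a
  generalize (∑ v ∈ T, (k v : ZMod 2)) = b
  generalize (S.card : ZMod 2) = p
  generalize (T.card : ZMod 2) = q
  generalize crossInv k T S = c
  revert a b p q c
  decide

/-- The finite set `S` is a disjoint union of two nonempty parts which `rel` does not link. -/
def IsSplit (S : Finset V) : Prop :=
  ∃ P Q : Finset V, P.Nonempty ∧ Q.Nonempty ∧ Disjoint P Q ∧ P ∪ Q = S ∧
    ∀ v ∈ P, ∀ w ∈ Q, ¬ rel v w ∧ ¬ rel w v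

variable {rel}

theorem IsSplit.two_le_card {S : Finset V} (hS : IsSplit rel S) : 2 ≤ S.card := by
  obtain ⟨P, Q, hP, hQ, hd, rfl, -⟩ := hS
  rw [Finset.card_union_of_disjoint hd]
  have := hP.card_pos
  have := hQ.card_pos
  omega

include hx hh hcomm in
/-- The transferred products vanish on shuffles: if `rel` does not link the parts `P` and `Q` of
`S`, then the only cuts which survive, by induction, separate `P` from `Q`, and the two of them
cancel. -/
theorem lamSum_eq_zero_of_isSplit {S : Finset V} (hS : IsSplit rel S) :
    lamSum 𝒜 h rel x k S = 0 := by
  induction hm : S.card using Nat.strong_induction_on generalizing S with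
  | _ m ih =>
    subst hm
    obtain ⟨P, Q, hP, hQ, hd, hPQ, hrel⟩ := hS
    have hW : ∀ D : Finset V, D ⊂ S → (D ∩ P).Nonempty → (D ∩ Q).Nonempty →
        hLamSum 𝒜 h rel x k D = 0 := by
      intro D hD h1 h2
      have hs : IsSplit rel D := by
        refine ⟨D ∩ P, D ∩ Q, h1, h2, ?_, ?_, ?_⟩
        · exact hd.mono Finset.inter_subset_right Finset.inter_subset_right
        · rw [← Finset.inter_union_distrib_left, hPQ, Finset.inter_eq_left]
          exact hD.subset
        · exact fun v hv w hw =>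
            hrel v (Finset.mem_inter.1 hv).2 w (Finset.mem_inter.1 hw).2
      rw [hLamSum_eq 𝒜 h rel x k hs.two_le_card, ih _ (Finset.card_lt_card hD) hs rfl, map_zero]
    have hSP : S \ P = Q := by
      rw [← hPQ, Finset.union_sdiff_left, Finset.sdiff_eq_self_of_disjoint hd.symm]
    have hSQ : S \ Q = P := by
      rw [← hPQ, Finset.union_sdiff_right, Finset.sdiff_eq_self_of_disjoint hd]
    have hPS : P ⊆ S := hPQ ▸ Finset.subset_union_left
    have hQS : Q ⊆ S := hPQ ▸ Finset.subset_union_right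
    have hne : P ≠ Q := by
      rintro rfl
      exact hP.ne_empty (disjoint_self.1 hd)
    have hsub : ({P, Q} : Finset (Finset V)) ⊆ lowerParts rel S := by
      intro D hD
      rw [Finset.mem_insert, Finset.mem_singleton] at hD
      rw [mem_lowerParts]
      rcases hD with rfl | rfl
      · rw [hSP]
        exact ⟨hPS, hP, hQ, fun v hv w hw => (hrel v hv w hw).2⟩
      · rw [hSQ]
        exact ⟨hQS, hQ, hP, fun v hv w hw => (hrel w hw v hv).1⟩
    rw [lamSum_eq_sum 𝒜 h rel x k hx, ← Finset.sum_subset hsub, Finset.sum_pair hne, hSP, hSQ,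
      cutProd_swap 𝒜 h rel x k hx hh hcomm hP hQ hd, neg_add_cancel]
    intro D hD hDn
    obtain ⟨hDS, hD1, hD2, -⟩ := mem_lowerParts.1 hD
    have hss : D ⊂ S := by
      rw [Finset.ssubset_iff_subset_ne]
      refine ⟨hDS, ?_⟩
      rintro rfl
      simp at hD2
    have hss' : S \ D ⊂ S := Finset.sdiff_ssubset hDS hD1
    by_contra hne0
    have key : ∀ E : Finset V, E ⊂ S → hLamSum 𝒜 h rel x k E ≠ 0 → E ⊆ P ∨ E ⊆ Q := by
      intro E hE h0
      by_contra hcon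
      push Not at hcon
      obtain ⟨⟨v, hv, hvP⟩, w, hw, hwQ⟩ := And.intro
        (Finset.not_subset.1 hcon.1) (Finset.not_subset.1 hcon.2)
      have hv' : v ∈ P ∪ Q := hPQ ▸ hE.subset hv
      have hw' : w ∈ P ∪ Q := hPQ ▸ hE.subset hw
      refine h0 (hW E hE ⟨w, ?_⟩ ⟨v, ?_⟩)
      · exact Finset.mem_inter.2 ⟨hw, (Finset.mem_union.1 hw').resolve_right hwQ⟩
      · exact Finset.mem_inter.2 ⟨hv, (Finset.mem_union.1 hv').resolve_left hvP⟩
    have h1 := key D hss fun h0 => hne0 (by rw [cutProd, h0, zero_mul, smul_zero])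
    have h2 := key (S \ D) hss' fun h0 => hne0 (by rw [cutProd, h0, mul_zero, smul_zero])
    apply hDn
    rw [Finset.mem_insert, Finset.mem_singleton]
    have hdis := Finset.disjoint_left.1 hd
    have hmem : ∀ v, v ∈ S ↔ v ∈ P ∨ v ∈ Q := fun v => by rw [← hPQ, Finset.mem_union]
    rcases h1 with h1 | h1 <;> rcases h2 with h2 | h2
    · obtain ⟨w, hw⟩ := hQ
      exfalso
      by_cases hwD : w ∈ D
      · exact hdis (h1 hwD) hw
      · exact hdis (h2 (Finset.mem_sdiff.2 ⟨hQS hw, hwD⟩)) hw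
    · left
      refine h1.antisymm fun v hv => ?_
      by_contra hvD
      exact hdis hv (h2 (Finset.mem_sdiff.2 ⟨hPS hv, hvD⟩))
    · right
      refine h1.antisymm fun v hv => ?_
      by_contra hvD
      exact hdis (h2 (Finset.mem_sdiff.2 ⟨hQS hv, hvD⟩)) hv
    · obtain ⟨w, hw⟩ := hP
      exfalso
      by_cases hwD : w ∈ D
      · exact hdis hw (h1 hwD)
      · exact hdis hw (h2 (Finset.mem_sdiff.2 ⟨hPS hw, hwD⟩))

include hx hh hcomm in
theorem cutProd_eq_zero_of_isSplit_left {S T : Finset V} (hS : IsSplit rel S) :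
    cutProd 𝒜 h rel x k S T = 0 := by
  rw [cutProd, hLamSum_eq 𝒜 h rel x k hS.two_le_card,
    lamSum_eq_zero_of_isSplit 𝒜 h x k hx hh hcomm hS, map_zero, zero_mul, smul_zero]

include hx hh hcomm in
theorem cutProd_eq_zero_of_isSplit_right {S T : Finset V} (hT : IsSplit rel T) :
    cutProd 𝒜 h rel x k S T = 0 := by
  rw [cutProd, hLamSum_eq 𝒜 h rel x k hT.two_le_card,
    lamSum_eq_zero_of_isSplit 𝒜 h x k hx hh hcomm hT, map_zero, mul_zero, smul_zero]

end SumProducts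

/-! ### Components of the spanning subgraphs of a forest -/

section Forest

variable {n : ℕ} {G : SimpleGraph (Fin n)}

theorem Edge.tail_lt_head (α : Edge G) : α.tail < α.head := α.2.1

theorem Edge.adj (α : Edge G) : G.Adj α.tail α.head := α.2.2

theorem exists_edge {v w : Fin n} (hvw : v < w) (hG : G.Adj v w) :
    ∃ α : Edge G, α.tail = v ∧ α.head = w :=
  ⟨⟨toLex (v, w), hvw, hG⟩, rfl, rfl⟩

theorem Edge.ext_tail_head {α β : Edge G} (ht : α.tail = β.tail) (hh : α.head = β.head) :
    α = β :=
  Subtype.ext (congrArg toLex (Prod.ext ht hh))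

theorem subgraphOf_adj {s : Finset (Edge G)} {v w : Fin n} :
    (subgraphOf s).Adj v w ↔
      ∃ α ∈ s, (α.tail = v ∧ α.head = w) ∨ (α.tail = w ∧ α.head = v) := by
  rw [subgraphOf, SimpleGraph.fromRel_adj]
  constructor
  · rintro ⟨-, ⟨α, hα, H⟩ | ⟨α, hα, H⟩⟩
    · exact ⟨α, hα, Or.inl H⟩
    · exact ⟨α, hα, Or.inr H⟩
  · rintro ⟨α, hα, ⟨rfl, rfl⟩ | ⟨rfl, rfl⟩⟩
    · exact ⟨α.tail_lt_head.ne, Or.inl ⟨α, hα, rfl, rfl⟩⟩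
    · exact ⟨α.tail_lt_head.ne', Or.inr ⟨α, hα, rfl, rfl⟩⟩

/-- `v` and `w` lie in the same component of `[G : s]`. -/
def Linked (s : Finset (Edge G)) (v w : Fin n) : Prop := (subgraphOf s).Reachable v w

theorem Linked.refl (s : Finset (Edge G)) (v : Fin n) : Linked s v v :=
  SimpleGraph.Reachable.refl v

theorem Linked.symm {s : Finset (Edge G)} {v w : Fin n} (H : Linked s v w) : Linked s w v :=
  SimpleGraph.Reachable.symm H

theorem Linked.trans {s : Finset (Edge G)} {u v w : Fin n} (H : Linked s u v)
    (H' : Linked s v w) : Linked s u w :=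
  SimpleGraph.Reachable.trans H H'

theorem linked_of_mem {s : Finset (Edge G)} {α : Edge G} (hα : α ∈ s) :
    Linked s α.tail α.head :=
  (subgraphOf_adj.2 ⟨α, hα, Or.inl ⟨rfl, rfl⟩⟩ : (subgraphOf s).Adj _ _).reachable

/-- Equivalence relations containing the pairs of ends of the edges in `s` contain `Linked s`. -/
theorem Linked.induction {s : Finset (Edge G)} {v w : Fin n} (H : Linked s v w)
    (P : Fin n → Prop) (hv : P v) (step : ∀ α ∈ s, P α.tail ↔ P α.head) : P w := by
  rw [Linked, SimpleGraph.reachable_iff_reflTransGen] at H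
  induction H with
  | refl => exact hv
  | tail _ hadj ih =>
    obtain ⟨α, hα, ⟨rfl, rfl⟩ | ⟨rfl, rfl⟩⟩ := subgraphOf_adj.1 hadj
    · exact (step α hα).1 ih
    · exact (step α hα).2 ih

theorem Linked.mono {s t : Finset (Edge G)} (hst : s ⊆ t) {v w : Fin n} (H : Linked s v w) :
    Linked t v w :=
  H.induction (Linked t v) (Linked.refl t v) fun _ hα =>
    ⟨fun K => K.trans (linked_of_mem (hst hα)), fun K => K.trans (linked_of_mem (hst hα)).symm⟩

theorem linked_of_reachable {v w : Fin n} (H : G.Reachable v w) :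
    Linked (Finset.univ : Finset (Edge G)) v w := by
  rw [SimpleGraph.reachable_iff_reflTransGen] at H
  induction H with
  | refl => exact Linked.refl _ _
  | tail _ hadj ih =>
    refine ih.trans ?_
    rcases lt_or_gt_of_ne hadj.ne with hlt | hlt
    · obtain ⟨α, rfl, rfl⟩ := exists_edge hlt hadj
      exact linked_of_mem (Finset.mem_univ α)
    · obtain ⟨α, rfl, rfl⟩ := exists_edge hlt hadj.symm
      exact (linked_of_mem (Finset.mem_univ α)).symm

/-- In a forest, an edge outside `s` is a bridge between two components of `[G : s]`. -/
theorem not_linked_of_notMem (hG : G.IsAcyclic) {s : Finset (Edge G)} {α : Edge G}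
    (hα : α ∉ s) : ¬ Linked s α.tail α.head := by
  intro H
  have hb := SimpleGraph.isAcyclic_iff_forall_adj_isBridge.1 hG α.adj
  rw [SimpleGraph.isBridge_iff] at hb
  refine hb (SimpleGraph.Reachable.mono ?_ H)
  intro v w hvw
  obtain ⟨β, hβ, hβe⟩ := subgraphOf_adj.1 hvw
  rw [SimpleGraph.deleteEdges_adj, Set.mem_singleton_iff]
  have hne : β ≠ α := by
    rintro rfl
    exact hα hβ
  have htl := α.tail_lt_head
  have htl' := β.tail_lt_head
  rcases hβe with ⟨rfl, rfl⟩ | ⟨rfl, rfl⟩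
  · refine ⟨β.adj, fun hc => ?_⟩
    rcases Sym2.eq_iff.1 hc with ⟨h1, h2⟩ | ⟨h1, h2⟩
    · exact hne (Edge.ext_tail_head h1 h2)
    · rw [h1, h2] at htl'
      exact lt_asymm htl htl'
  · refine ⟨β.adj.symm, fun hc => ?_⟩
    rcases Sym2.eq_iff.1 hc with ⟨h1, h2⟩ | ⟨h1, h2⟩
    · rw [h1, h2] at htl'
      exact lt_asymm htl htl'
    · exact hne (Edge.ext_tail_head h2 h1)

/-- Adding the edge `α` joins the components of its ends and no others. -/
theorem Linked.of_erase {s : Finset (Edge G)} {α : Edge G} {v w : Fin n}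
    (H : Linked s v w) :
    Linked (s.erase α) v w ∨ (Linked (s.erase α) v α.tail ∧ Linked (s.erase α) α.head w) ∨
      (Linked (s.erase α) v α.head ∧ Linked (s.erase α) α.tail w) := by
  refine H.induction (fun w => Linked (s.erase α) v w ∨
    (Linked (s.erase α) v α.tail ∧ Linked (s.erase α) α.head w) ∨
      (Linked (s.erase α) v α.head ∧ Linked (s.erase α) α.tail w))
    (Or.inl (Linked.refl _ _)) fun β hβ => ?_
  by_cases hβα : β = α
  · subst hβα
    constructor
    · rintro (K | ⟨K, -⟩ | ⟨K, K'⟩)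
      · exact Or.inr (Or.inl ⟨K, Linked.refl _ _⟩)
      · exact Or.inr (Or.inl ⟨K, Linked.refl _ _⟩)
      · exact Or.inl K
    · rintro (K | ⟨K, -⟩ | ⟨K, K'⟩)
      · exact Or.inr (Or.inr ⟨K, Linked.refl _ _⟩)
      · exact Or.inl K
      · exact Or.inr (Or.inr ⟨K, Linked.refl _ _⟩)
  · have hL := linked_of_mem (Finset.mem_erase.2 ⟨hβα, hβ⟩)
    constructor
    · rintro (K | ⟨K, K'⟩ | ⟨K, K'⟩)
      · exact Or.inl (K.trans hL)
      · exact Or.inr (Or.inl ⟨K, K'.trans hL⟩)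
      · exact Or.inr (Or.inr ⟨K, K'.trans hL⟩)
    · rintro (K | ⟨K, K'⟩ | ⟨K, K'⟩)
      · exact Or.inl (K.trans hL.symm)
      · exact Or.inr (Or.inl ⟨K, K'.trans hL.symm⟩)
      · exact Or.inr (Or.inr ⟨K, K'.trans hL.symm⟩)

open Classical in
/-- The vertex set of the component of `v` in `[G : s]`. -/
def cell (s : Finset (Edge G)) (v : Fin n) : Finset (Fin n) :=
  Finset.univ.filter fun w => Linked s v w

@[simp] theorem mem_cell {s : Finset (Edge G)} {v w : Fin n} : w ∈ cell s v ↔ Linked s v w := by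
  simp [cell]

theorem self_mem_cell (s : Finset (Edge G)) (v : Fin n) : v ∈ cell s v :=
  mem_cell.2 (Linked.refl s v)

theorem cell_eq_of_linked {s : Finset (Edge G)} {v w : Fin n} (H : Linked s v w) :
    cell s v = cell s w := by
  ext u
  simp only [mem_cell]
  exact ⟨H.symm.trans, H.trans⟩

/-- The smallest vertex of the component of `v` in `[G : s]`. -/
def rep (s : Finset (Edge G)) (v : Fin n) : Fin n := (compOf s v).1

theorem linked_rep (s : Finset (Edge G)) (v : Fin n) : Linked s v (rep s v) := by
  classical
  have hm := Finset.min'_mem (Finset.univ.filter fun w => (subgraphOf s).Reachable v w)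
    ⟨v, by simp⟩
  exact (Finset.mem_filter.1 hm).2

theorem rep_le_of_linked {s : Finset (Edge G)} {v w : Fin n} (H : Linked s v w) :
    rep s v ≤ w :=
  (compOf s v).2 w ((linked_rep s v).symm.trans H)

theorem eq_rep {s : Finset (Edge G)} {u v : Fin n} (H : Linked s v u)
    (hu : ∀ w, Linked s v w → u ≤ w) : u = rep s v :=
  le_antisymm (hu _ (linked_rep s v)) (rep_le_of_linked H)

theorem rep_eq_rep_iff {s : Finset (Edge G)} {v w : Fin n} :
    rep s v = rep s w ↔ Linked s v w := by
  constructor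
  · intro H
    exact (linked_rep s v).trans (H ▸ (linked_rep s w).symm)
  · intro H
    refine eq_rep (H.symm.trans (linked_rep s v)) fun u hu => ?_
    exact rep_le_of_linked (H.trans hu)

theorem mem_cell_iff_rep {s : Finset (Edge G)} {v w : Fin n} :
    w ∈ cell s v ↔ rep s w = rep s v := by
  rw [mem_cell, rep_eq_rep_iff]
  exact ⟨Linked.symm, Linked.symm⟩

theorem rep_rep (s : Finset (Edge G)) (v : Fin n) : rep s (rep s v) = rep s v :=
  rep_eq_rep_iff.2 (linked_rep s v).symm

theorem rep_le (s : Finset (Edge G)) (v : Fin n) : rep s v ≤ v :=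
  rep_le_of_linked (Linked.refl s v)

@[simp] theorem rep_coe {s : Finset (Edge G)} (c : Comp s) : rep s c.1 = c.1 :=
  (eq_rep (Linked.refl s c.1) c.2).symm

theorem rep_eq_self_iff {s : Finset (Edge G)} {v : Fin n} :
    rep s v = v ↔ ∀ w, (subgraphOf s).Reachable v w → v ≤ w := by
  constructor
  · intro H w hw
    exact H ▸ rep_le_of_linked hw
  · exact fun H => (eq_rep (Linked.refl s v) H).symm

/-- The components of `[G : s]` are those of `[G : s - α]`, with the components of the ends of
`α` (represented by `m₁ < m₂`) joined. -/
theorem rep_eq_ite {s : Finset (Edge G)} {α : Edge G} (hα : α ∈ s) {m₁ m₂ : Fin n}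
    (h₁₂ : m₁ < m₂)
    (hm : (rep (s.erase α) α.tail = m₁ ∧ rep (s.erase α) α.head = m₂) ∨
      (rep (s.erase α) α.tail = m₂ ∧ rep (s.erase α) α.head = m₁)) (v : Fin n) :
    rep s v = if rep (s.erase α) v = m₂ then m₁ else rep (s.erase α) v := by
  have hsub : s.erase α ⊆ s := Finset.erase_subset _ _
  have hlink := linked_of_mem hα
  have key : ∀ v, rep (s.erase α) v = m₁ ∨ rep (s.erase α) v = m₂ → rep s v = m₁ := by
    intro v hv
    have ht : Linked s v α.tail ∧ Linked s m₁ α.tail := by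
      rcases hm with ⟨rfl, rfl⟩ | ⟨rfl, rfl⟩
      · refine ⟨?_, ((linked_rep _ _).mono hsub).symm⟩
        rcases hv with hv | hv
        · exact (rep_eq_rep_iff.1 hv).mono hsub
        · exact ((rep_eq_rep_iff.1 hv).mono hsub).trans hlink.symm
      · refine ⟨?_, ((linked_rep _ _).mono hsub).symm.trans hlink.symm⟩
        rcases hv with hv | hv
        · exact ((rep_eq_rep_iff.1 hv).mono hsub).trans hlink.symm
        · exact (rep_eq_rep_iff.1 hv).mono hsub
    symm
    refine eq_rep (ht.1.trans ht.2.symm) fun w hw => ?_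
    have hw' : Linked s α.tail w := ht.1.symm.trans hw
    have : rep (s.erase α) w = m₁ ∨ rep (s.erase α) w = m₂ := by
      rcases hw'.of_erase (α := α) with K | ⟨-, K⟩ | ⟨-, K⟩
      · rw [← rep_eq_rep_iff.2 K]
        rcases hm with ⟨H, -⟩ | ⟨H, -⟩ <;> simp [H]
      · rw [← rep_eq_rep_iff.2 K]
        rcases hm with ⟨-, H⟩ | ⟨-, H⟩ <;> simp [H]
      · rw [← rep_eq_rep_iff.2 K]
        rcases hm with ⟨H, -⟩ | ⟨H, -⟩ <;> simp [H]
    have hle := rep_le (s.erase α) w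
    rcases this with H | H
    · exact H ▸ hle
    · exact h₁₂.le.trans (H ▸ hle)
  split_ifs with hv
  · exact key v (Or.inr hv)
  · by_cases hv' : rep (s.erase α) v = m₁
    · rw [key v (Or.inl hv'), hv']
    · symm
      refine eq_rep ((linked_rep _ _).mono hsub) fun w hw => ?_
      rcases hw.of_erase (α := α) with K | ⟨K, -⟩ | ⟨K, -⟩
      · exact rep_le_of_linked K
      · exfalso
        rw [← rep_eq_rep_iff] at K
        rcases hm with ⟨H, -⟩ | ⟨H, -⟩
        · exact hv' (K.trans H)
        · exact hv (K.trans H)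
      · exfalso
        rw [← rep_eq_rep_iff] at K
        rcases hm with ⟨-, H⟩ | ⟨-, H⟩
        · exact hv (K.trans H)
        · exact hv' (K.trans H)

/-- The relation given by the oriented edges of `G`. -/
def edgeRel (G : SimpleGraph (Fin n)) (v w : Fin n) : Prop := v < w ∧ G.Adj v w

theorem edgeRel_iff {v w : Fin n} : edgeRel G v w ↔ ∃ α : Edge G, α.tail = v ∧ α.head = w :=
  ⟨fun H => exists_edge H.1 H.2, by
    rintro ⟨α, rfl, rfl⟩
    exact ⟨α.tail_lt_head, α.adj⟩⟩

/-- A set which is not split is connected by the edges inside it. -/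
theorem linked_of_not_isSplit {S : Finset (Fin n)} (hS : ¬ IsSplit (edgeRel G) S)
    {t : Finset (Edge G)} (ht : ∀ α : Edge G, α.tail ∈ S → α.head ∈ S → α ∈ t) {v w : Fin n}
    (hv : v ∈ S) (hw : w ∈ S) : Linked t v w := by
  classical
  by_contra hcon
  refine hS ⟨S.filter fun u => Linked t v u, S.filter fun u => ¬ Linked t v u,
    ⟨v, by simp [hv, Linked.refl]⟩, ⟨w, by simp [hw, hcon]⟩,
    Finset.disjoint_filter_filter_not _ _ _, Finset.filter_union_filter_not_eq _ _, ?_⟩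
  intro a ha b hb
  rw [Finset.mem_filter] at ha hb
  refine ⟨fun hab => ?_, fun hab => ?_⟩
  · obtain ⟨α, rfl, rfl⟩ := edgeRel_iff.1 hab
    exact hb.2 (ha.2.trans (linked_of_mem (ht α ha.1 hb.1)))
  · obtain ⟨α, rfl, rfl⟩ := edgeRel_iff.1 hab
    exact hb.2 (ha.2.trans (linked_of_mem (ht α hb.1 ha.1)).symm)

theorem cell_sdiff_cell (hG : G.IsAcyclic) {s : Finset (Edge G)} {α : Edge G} (hα : α ∈ s) :
    cell s α.tail \ cell (s.erase α) α.tail = cell (s.erase α) α.head := by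
  have hbr := not_linked_of_notMem hG (Finset.notMem_erase α s)
  ext w
  simp only [Finset.mem_sdiff, mem_cell]
  constructor
  · rintro ⟨h1, h2⟩
    rcases h1.of_erase (α := α) with K | ⟨-, K⟩ | ⟨K, -⟩
    · exact absurd K h2
    · exact K
    · exact absurd K hbr
  · intro K
    exact ⟨(linked_of_mem hα).trans (K.mono (Finset.erase_subset _ _)),
      fun K' => hbr (K'.trans K.symm)⟩

theorem cell_erase_mem_lowerParts (hG : G.IsAcyclic) {s : Finset (Edge G)} {α : Edge G}
    (hα : α ∈ s) : cell (s.erase α) α.tail ∈ lowerParts (edgeRel G) (cell s α.tail) := by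
  have hsub : s.erase α ⊆ s := Finset.erase_subset _ _
  rw [mem_lowerParts, cell_sdiff_cell hG hα]
  refine ⟨fun w hw => mem_cell.2 ((mem_cell.1 hw).mono hsub), ⟨_, self_mem_cell _ _⟩,
    ⟨_, self_mem_cell _ _⟩, fun v hv w hw hwv => ?_⟩
  obtain ⟨β, rfl, rfl⟩ := edgeRel_iff.1 hwv
  rw [mem_cell] at hv hw
  have hbr := not_linked_of_notMem hG (Finset.notMem_erase α s)
  by_cases hβ : β ∈ s.erase α
  · exact hbr (hv.trans ((linked_of_mem hβ).symm.trans hw.symm))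
  · by_cases hβα : β = α
    · subst hβα
      exact hbr hw.symm
    · have hβs : β ∉ s := fun H => hβ (Finset.mem_erase.2 ⟨hβα, H⟩)
      exact not_linked_of_notMem hG hβs
        (((hw.mono hsub).symm.trans (linked_of_mem hα).symm).trans (hv.mono hsub))

/-- If neither `D` nor its complement in a component of `[G : s]` is split, then `D` is cut out by
one edge. -/
theorem exists_cell_erase_eq (hG : G.IsAcyclic) {s : Finset (Edge G)} {v : Fin n}
    {D : Finset (Fin n)} (hD : D ∈ lowerParts (edgeRel G) (cell s v))
    (h₁ : ¬ IsSplit (edgeRel G) D) (h₂ : ¬ IsSplit (edgeRel G) (cell s v \ D)) :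
    ∃ α ∈ s, α.tail ∈ cell s v ∧ cell (s.erase α) α.tail = D := by
  obtain ⟨hDS, ⟨a, ha⟩, ⟨b, hb⟩, hlow⟩ := mem_lowerParts.1 hD
  have hab : Linked s a b :=
    (mem_cell.1 (hDS ha)).symm.trans (mem_cell.1 (Finset.mem_sdiff.1 hb).1)
  have hin : ∀ β : Edge G, β.tail ∈ cell s v → β.head ∈ cell s v → β ∈ s := by
    intro β h1 h2
    by_contra hβ
    exact not_linked_of_notMem hG hβ ((mem_cell.1 h1).symm.trans (mem_cell.1 h2))
  have hcl : ∀ β ∈ s, (β.tail ∈ cell s v ↔ β.head ∈ cell s v) := by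
    intro β hβ
    simp only [mem_cell]
    exact ⟨fun H => H.trans (linked_of_mem hβ), fun H => H.trans (linked_of_mem hβ).symm⟩
  obtain ⟨α, hα, hαt, hαh⟩ : ∃ α ∈ s, α.tail ∈ D ∧ α.head ∈ cell s v \ D := by
    by_contra hcon
    push Not at hcon
    refine (Finset.mem_sdiff.1 hb).2 (hab.induction (· ∈ D) ha fun β hβ => ⟨fun H => ?_,
      fun H => ?_⟩)
    · by_contra H'
      exact hcon β hβ H (Finset.mem_sdiff.2 ⟨(hcl β hβ).1 (hDS H), H'⟩)
    · by_contra H'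
      exact hlow _ H _ (Finset.mem_sdiff.2 ⟨(hcl β hβ).2 (hDS H), H'⟩)
        (edgeRel_iff.2 ⟨β, rfl, rfl⟩)
  refine ⟨α, hα, hDS hαt, ?_⟩
  ext w
  rw [mem_cell]
  constructor
  · intro H
    refine H.induction (· ∈ D) hαt fun β hβ => ?_
    obtain ⟨hβα, hβs⟩ := Finset.mem_erase.1 hβ
    constructor
    · intro H1
      by_contra H2
      have H3 : β.head ∈ cell s v \ D := Finset.mem_sdiff.2 ⟨(hcl β hβs).1 (hDS H1), H2⟩
      have k1 : Linked (s.erase β) β.tail α.tail := by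
        refine linked_of_not_isSplit h₁ (fun γ g1 g2 => Finset.mem_erase.2 ⟨?_, ?_⟩) H1 hαt
        · rintro rfl
          exact H2 g2
        · exact hin γ (hDS g1) (hDS g2)
      have k2 : Linked (s.erase β) α.head β.head := by
        refine linked_of_not_isSplit h₂ (fun γ g1 g2 => Finset.mem_erase.2 ⟨?_, ?_⟩) hαh H3
        · rintro rfl
          exact (Finset.mem_sdiff.1 g1).2 H1
        · exact hin γ (Finset.mem_sdiff.1 g1).1 (Finset.mem_sdiff.1 g2).1
      have k3 : Linked (s.erase β) α.tail α.head :=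
        linked_of_mem (Finset.mem_erase.2 ⟨Ne.symm hβα, hα⟩)
      exact not_linked_of_notMem hG (Finset.notMem_erase β s) ((k1.trans k3).trans k2)
    · intro H1
      by_contra H2
      exact hlow _ H1 _ (Finset.mem_sdiff.2 ⟨(hcl β hβs).2 (hDS H1), H2⟩)
        (edgeRel_iff.2 ⟨β, rfl, rfl⟩)
  · intro hw
    refine linked_of_not_isSplit h₁ (fun γ g1 g2 => Finset.mem_erase.2 ⟨?_, ?_⟩) hαt hw
    · rintro rfl
      exact (Finset.mem_sdiff.1 hαh).2 g2
    · exact hin γ (hDS g1) (hDS g2)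

theorem cell_erase_injOn (hG : G.IsAcyclic) (s : Finset (Edge G)) :
    Set.InjOn (fun α : Edge G => cell (s.erase α) α.tail) (s : Set (Edge G)) := by
  intro α hα β hβ hab
  by_contra hne
  have hab' : cell (s.erase α) α.tail = cell (s.erase β) β.tail := hab
  have hL : Linked (s.erase α) β.tail β.head :=
    linked_of_mem (Finset.mem_erase.2 ⟨Ne.symm hne, hβ⟩)
  have h1 : β.tail ∈ cell (s.erase α) α.tail := hab' ▸ self_mem_cell _ _
  have h2 : β.head ∈ cell (s.erase β) β.tail :=
    hab' ▸ mem_cell.2 ((mem_cell.1 h1).trans hL)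
  exact not_linked_of_notMem hG (Finset.notMem_erase β s) (mem_cell.1 h2)

variable {R : Type*} [CommRing R] {B : Type*} [Ring B] [Algebra R B]
  (𝒜 : ℤ → Submodule R B) [GradedAlgebra 𝒜] (h : B →ₗ[R] B)
  (x : Fin n → B) (k : Fin n → ℤ) (hx : ∀ v, x v ∈ 𝒜 (k v))
  (hh : ∀ i, ∀ y ∈ 𝒜 i, h y ∈ 𝒜 (i - 1))
  (hcomm : ∀ i j, ∀ y ∈ 𝒜 i, ∀ z ∈ 𝒜 j, y * z = (i * j).negOnePow • (z * y))

include hx hh hcomm in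
/-- On a component of a forest, only the cuts along single edges contribute to the sum over
linear extensions: all other cuts involve a split set. -/
theorem lamSum_cell (hG : G.IsAcyclic) (s : Finset (Edge G)) (v : Fin n) :
    lamSum 𝒜 h (edgeRel G) x k (cell s v) =
      ∑ α ∈ s with α.tail ∈ cell s v, cutProd 𝒜 h (edgeRel G) x k
        (cell (s.erase α) α.tail) (cell (s.erase α) α.head) := by
  have hcell : ∀ α ∈ s.filter (fun α => α.tail ∈ cell s v), cell s v = cell s α.tail :=
    fun α hα => cell_eq_of_linked (mem_cell.1 (Finset.mem_filter.1 hα).2)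
  rw [lamSum_eq_sum 𝒜 h (edgeRel G) x k hx]
  symm
  refine Finset.sum_of_injOn (fun α => cell (s.erase α) α.tail)
    ((cell_erase_injOn hG s).mono fun α hα => (Finset.mem_filter.1 hα).1) ?_ ?_ ?_
  · intro α hα
    rw [hcell α hα]
    exact cell_erase_mem_lowerParts hG (Finset.mem_filter.1 hα).1
  · intro D hD hDn
    by_cases h1 : IsSplit (edgeRel G) D
    · exact cutProd_eq_zero_of_isSplit_left 𝒜 h x k hx hh hcomm h1
    by_cases h2 : IsSplit (edgeRel G) (cell s v \ D)
    · exact cutProd_eq_zero_of_isSplit_right 𝒜 h x k hx hh hcomm h2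
    obtain ⟨α, hα, hαv, rfl⟩ := exists_cell_erase_eq hG hD h1 h2
    exact absurd ⟨α, Finset.mem_coe.2 (Finset.mem_filter.2 ⟨hα, hαv⟩), rfl⟩ hDn
  · intro α hα
    rw [hcell α hα, cell_sdiff_cell hG (Finset.mem_filter.1 hα).1]

end Forest

/-! ### Ordered products in an exterior algebra -/

section Exterior

variable {S : Type*} [CommRing S] {M : Type*} [AddCommGroup M] [Module S M]
  {β : Type*} [LinearOrder β]

/-- The exterior product of the vectors `F b`, `b ∈ s`, in increasing order of `b`. -/
def sortProd (F : β → M) (s : Finset β) : ExteriorAlgebra S M :=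
  ((s.sort (· ≤ ·)).map fun b => ExteriorAlgebra.ι S (F b)).prod

theorem ι_mul_ι_swap (x y : M) :
    ExteriorAlgebra.ι S x * ExteriorAlgebra.ι S y =
      -(ExteriorAlgebra.ι S y * ExteriorAlgebra.ι S x) :=
  eq_neg_of_add_eq_zero_left (ExteriorAlgebra.ι_add_mul_swap x y)

theorem ι_mul_list_prod (x : M) (l : List M) :
    ExteriorAlgebra.ι S x * (l.map (ExteriorAlgebra.ι S)).prod =
      sgn S (l.length : ZMod 2) • ((l.map (ExteriorAlgebra.ι S)).prod * ExteriorAlgebra.ι S x) := by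
  induction l with
  | nil => simp
  | cons y l ih =>
    rw [List.map_cons, List.prod_cons, ← mul_assoc, ι_mul_ι_swap, neg_mul, mul_assoc, ih,
      List.length_cons, Nat.cast_succ, sgn_add, sgn_one, mul_smul_comm, ← mul_assoc, mul_neg_one,
      neg_smul]

theorem ι_mul_sortProd (F : β → M) (x : M) (s : Finset β) :
    ExteriorAlgebra.ι S x * sortProd F s =
      sgn S (s.card : ZMod 2) • (sortProd F s * ExteriorAlgebra.ι S x) := by
  have := ι_mul_list_prod (S := S) x ((s.sort (· ≤ ·)).map F)
  rwa [List.map_map, List.length_map, Finset.length_sort] at this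

theorem sortProd_erase [inst : DecidableEq β] (F : β → M) {s : Finset β} {a : β} (ha : a ∈ s) :
    sortProd F s = sgn S (((s.filter (· < a)).card : ℕ) : ZMod 2) •
      (ExteriorAlgebra.ι S (F a) * sortProd F (s.erase a)) := by
  obtain rfl : inst = (fun a b => LinearOrder.toDecidableEq a b) := Subsingleton.elim _ _
  induction s using Finset.induction_on_min with
  | empty => simp at ha
  | insert m t hm ih =>
    have hmt : m ∉ t := fun H => lt_irrefl _ (hm m H)
    have hins : ∀ u ⊆ t, sortProd (S := S) F (insert m u) =
        ExteriorAlgebra.ι S (F m) * sortProd F u := by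
      intro u hu
      rw [sortProd, Finset.sort_insert _ (fun b hb => (hm b (hu hb)).le) (fun H => hmt (hu H)),
        List.map_cons, List.prod_cons, sortProd]
    rcases Finset.mem_insert.1 ha with rfl | ha'
    · have hf : (insert a t).filter (· < a) = ∅ := by
        ext b
        simp only [Finset.mem_filter, Finset.mem_insert, Finset.notMem_empty, iff_false]
        rintro ⟨rfl | hb, hlt⟩
        · exact lt_irrefl _ hlt
        · exact lt_asymm hlt (hm b hb)
      rw [hf, Finset.erase_insert hmt, hins t subset_rfl]
      simp
    · have hma := hm a ha'
      have hf : (insert m t).filter (· < a) = insert m (t.filter (· < a)) := by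
        rw [Finset.filter_insert, if_pos hma]
      have he : (insert m t).erase a = insert m (t.erase a) :=
        Finset.erase_insert_of_ne hma.ne
      rw [hf, he, hins t subset_rfl, hins _ (Finset.erase_subset _ _), ih ha',
        Finset.card_insert_of_notMem (fun H => hmt (Finset.mem_filter.1 H).1), Nat.cast_succ,
        sgn_add, sgn_one, mul_smul_comm, ← mul_assoc, ι_mul_ι_swap, neg_mul, mul_assoc, smul_neg,
        mul_neg_one, neg_smul]

theorem ι_mul_sortProd_eq_zero (F : β → M) {s : Finset β} {x : M}
    (hx : x ∈ Submodule.span S (F '' s)) : ExteriorAlgebra.ι S x * sortProd F s = 0 := by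
  induction hx using Submodule.span_induction with
  | mem x hx =>
    obtain ⟨a, ha, rfl⟩ := hx
    rw [sortProd_erase F (Finset.mem_coe.1 ha), mul_smul_comm, ← mul_assoc,
      ExteriorAlgebra.ι_sq_zero, zero_mul, smul_zero]
  | zero => simp
  | add x y _ _ hx hy => rw [map_add, add_mul, hx, hy, add_zero]
  | smul c x _ hx => rw [map_smul, smul_mul_assoc, hx, smul_zero]

/-- The linear form on the exterior algebra of `S^n` which sends a product of `n` vectors to the
determinant of the matrix with these rows. -/
def detForm (S : Type*) [CommRing S] (n : ℕ) : ExteriorAlgebra S (Fin n → S) →ₗ[S] S :=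
  ExteriorAlgebra.liftAlternating (Pi.single n Matrix.detRowAlternating)

theorem detForm_list_prod {n : ℕ} (l : List (Fin n → S)) (hl : l.length = n) :
    detForm S n (l.map (ExteriorAlgebra.ι S)).prod =
      Matrix.det (Matrix.of fun i : Fin n => l[(i : ℕ)]'(hl.symm ▸ i.2)) := by
  have e : (l.map (ExteriorAlgebra.ι S)).prod =
      ExteriorAlgebra.ιMulti S n fun i : Fin n => l[(i : ℕ)]'(hl.symm ▸ i.2) := by
    rw [ExteriorAlgebra.ιMulti_apply]
    congr 1
    refine List.ext_getElem (by simp [hl]) fun i h1 h2 => ?_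
    simp
  rw [e, detForm, ExteriorAlgebra.liftAlternating_apply_ιMulti, Pi.single_eq_same]
  rfl

end Exterior

/-! ### The orientation of a spanning forest -/

section Orientation

variable {n : ℕ} {G : SimpleGraph (Fin n)}

/-- The boundary `j - i` of the edge `i → j`. -/
def edgeVec (α : Edge G) : Fin n → ℤ := Pi.single α.head 1 - Pi.single α.tail 1

/-- The set of the smallest vertices of the components of `[G : s]`. -/
def reps (s : Finset (Edge G)) : Finset (Fin n) := Finset.univ.filter fun v => rep s v = v

theorem mem_reps {s : Finset (Edge G)} {v : Fin n} : v ∈ reps s ↔ rep s v = v := by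
  simp [reps]

/-- The exterior product of the boundaries of the edges in `s` and of the smallest vertices of
the components of `[G : s]`. -/
def orientation (s : Finset (Edge G)) : ExteriorAlgebra ℤ (Fin n → ℤ) :=
  sortProd edgeVec s * sortProd (fun v => Pi.single v 1) (reps s)

theorem single_sub_single_mem_span {s : Finset (Edge G)} {v w : Fin n} (H : Linked s v w) :
    (Pi.single w 1 - Pi.single v 1 : Fin n → ℤ) ∈ Submodule.span ℤ (edgeVec '' (s : Set (Edge G))) := by
  refine H.induction (fun w => (Pi.single w 1 - Pi.single v 1 : Fin n → ℤ) ∈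
    Submodule.span ℤ (edgeVec '' (s : Set (Edge G)))) (by simp) fun α hα => ?_
  have hα' : edgeVec α ∈ Submodule.span ℤ (edgeVec '' (s : Set (Edge G))) :=
    Submodule.subset_span ⟨α, hα, rfl⟩
  rw [edgeVec] at hα'
  constructor
  · intro K
    convert Submodule.add_mem _ K hα' using 1
    abel
  · intro K
    convert Submodule.sub_mem _ K hα' using 1
    abel

theorem ι_mul_orientation_eq_zero {s : Finset (Edge G)} (T : Finset (Fin n)) {x y : Fin n → ℤ}
    (hx : x ∈ Submodule.span ℤ (edgeVec '' (s : Set (Edge G))))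
    (hy : y ∈ Submodule.span ℤ ((fun v => Pi.single v 1) '' (T : Set (Fin n)))) :
    ExteriorAlgebra.ι ℤ (x + y) *
      (sortProd edgeVec s * sortProd (fun v => Pi.single v 1) T) = 0 := by
  rw [map_add, add_mul, ← mul_assoc, ι_mul_sortProd_eq_zero _ hx, zero_mul, zero_add, ← mul_assoc,
    ι_mul_sortProd, smul_mul_assoc, mul_assoc, ι_mul_sortProd_eq_zero _ hy, mul_zero, smul_zero]

theorem reps_eq_erase {s : Finset (Edge G)} {α : Edge G} (hα : α ∈ s) {m₁ m₂ : Fin n}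
    (h₁₂ : m₁ < m₂)
    (hm : (rep (s.erase α) α.tail = m₁ ∧ rep (s.erase α) α.head = m₂) ∨
      (rep (s.erase α) α.tail = m₂ ∧ rep (s.erase α) α.head = m₁)) :
    reps s = (reps (s.erase α)).erase m₂ := by
  ext v
  rw [Finset.mem_erase, mem_reps, mem_reps, rep_eq_ite hα h₁₂ hm]
  have h1 : rep (s.erase α) m₁ = m₁ := by
    rcases hm with ⟨rfl, -⟩ | ⟨-, rfl⟩ <;> exact rep_rep _ _
  split_ifs with hv
  · constructor
    · rintro rfl
      exact absurd (h1.symm.trans hv) h₁₂.ne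
    · rintro ⟨h2, h3⟩
      exact absurd (h3.symm.trans hv) h2
  · constructor
    · intro H
      refine ⟨?_, H⟩
      rintro rfl
      exact hv H
    · exact fun H => H.2

/-- Adding an edge `α` which joins the components of `m₁ < m₂` replaces the vector `m₂` in the
orientation by the boundary of `α`. -/
theorem orientation_eq {s : Finset (Edge G)} {α : Edge G} (hα : α ∈ s) {m₁ m₂ : Fin n}
    (h₁₂ : m₁ < m₂) {e : ZMod 2}
    (hm : (e = 0 ∧ rep (s.erase α) α.tail = m₁ ∧ rep (s.erase α) α.head = m₂) ∨
      (e = 1 ∧ rep (s.erase α) α.tail = m₂ ∧ rep (s.erase α) α.head = m₁)) :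
    orientation s = sgn ℤ (((s.filter (· < α)).card : ℕ) + (s.erase α).card +
      (((reps (s.erase α)).filter (· < m₂)).card : ℕ) + e) • orientation (s.erase α) := by
  have hm' := hm.imp And.right And.right
  have hreps := reps_eq_erase hα h₁₂ hm'
  have hm2 : m₂ ∈ reps (s.erase α) := by
    rw [mem_reps]
    rcases hm' with ⟨-, rfl⟩ | ⟨rfl, -⟩ <;> exact rep_rep _ _
  have hm1 : m₁ ∈ reps s := by
    rw [hreps, Finset.mem_erase, mem_reps]
    refine ⟨h₁₂.ne, ?_⟩
    rcases hm' with ⟨rfl, -⟩ | ⟨-, rfl⟩ <;> exact rep_rep _ _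
  set X : ExteriorAlgebra ℤ (Fin n → ℤ) := sortProd (S := ℤ) edgeVec (s.erase α) *
    sortProd (fun v => (Pi.single v 1 : Fin n → ℤ)) (reps s) with hX
  have h1 : orientation s = sgn ℤ (((s.filter (· < α)).card : ℕ) : ZMod 2) •
      (ExteriorAlgebra.ι ℤ (edgeVec α) * X) := by
    rw [orientation, sortProd_erase edgeVec hα, smul_mul_assoc, mul_assoc, hX]
  have h2 : orientation (s.erase α) = sgn ℤ ((s.erase α).card +
      (((reps (s.erase α)).filter (· < m₂)).card : ℕ)) •
        (ExteriorAlgebra.ι ℤ (Pi.single m₂ 1) * X) := by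
    rw [orientation, sortProd_erase _ hm2, ← hreps, mul_smul_comm, hX, ← mul_assoc,
      ← mul_assoc, ι_mul_sortProd, smul_mul_assoc, smul_smul, sgn_add, mul_right_comm,
      sgn_mul_self, one_mul]
  have h3 : ExteriorAlgebra.ι ℤ (edgeVec α) * X =
      sgn ℤ e • (ExteriorAlgebra.ι ℤ (Pi.single m₂ 1) * X) := by
    rw [← sub_eq_zero, ← smul_mul_assoc, ← sub_mul, ← map_smul, ← map_sub]
    have k1 := single_sub_single_mem_span (linked_rep (s.erase α) α.head)
    have k2 := single_sub_single_mem_span (linked_rep (s.erase α) α.tail)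
    have k3 : (Pi.single m₁ 1 : Fin n → ℤ) ∈
        Submodule.span ℤ ((fun v => Pi.single v 1) '' (reps s : Set (Fin n))) :=
      Submodule.subset_span ⟨m₁, hm1, rfl⟩
    rcases hm with ⟨rfl, ht, hh⟩ | ⟨rfl, ht, hh⟩
    · rw [ht] at k2
      rw [hh] at k1
      rw [hX, ← ι_mul_orientation_eq_zero _ (Submodule.sub_mem _ k2 k1) (Submodule.neg_mem _ k3)]
      congr 2
      rw [sgn_zero, one_smul, edgeVec]
      abel
    · rw [ht] at k2
      rw [hh] at k1
      rw [hX, ← ι_mul_orientation_eq_zero _ (Submodule.sub_mem _ k2 k1) k3]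
      congr 2
      rw [sgn_one, neg_smul, one_smul, edgeVec]
      abel
  rw [h1, h2, h3, smul_smul, smul_smul, ← sgn_add, ← sgn_add]
  congr 2
  have key : ∀ a b c e : ZMod 2, a + e = a + b + c + e + (b + c) := by decide
  exact key _ _ _ _

end Orientation

section OrientationSign

variable {n : ℕ} {G : SimpleGraph (Fin n)}

/-- The sign of the orientation of `[G : s]` relative to the standard basis of `ℤ^n`; it
generalizes the sign of a tree to spanning forests. -/
def forestSign (s : Finset (Edge G)) : ℤ := detForm ℤ n (orientation s)

theorem forestSign_eq {s : Finset (Edge G)} {α : Edge G} (hα : α ∈ s) {m₁ m₂ : Fin n}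
    (h₁₂ : m₁ < m₂) {e : ZMod 2}
    (hm : (e = 0 ∧ rep (s.erase α) α.tail = m₁ ∧ rep (s.erase α) α.head = m₂) ∨
      (e = 1 ∧ rep (s.erase α) α.tail = m₂ ∧ rep (s.erase α) α.head = m₁)) :
    forestSign s = sgn ℤ (((s.filter (· < α)).card : ℕ) + (s.erase α).card +
      (((reps (s.erase α)).filter (· < m₂)).card : ℕ) + e) * forestSign (s.erase α) := by
  rw [forestSign, orientation_eq hα h₁₂ hm, map_smul, smul_eq_mul, forestSign]

theorem rep_empty (v : Fin n) : rep (∅ : Finset (Edge G)) v = v := by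
  have H : Linked (∅ : Finset (Edge G)) v (rep ∅ v) := linked_rep _ v
  exact (H.induction (fun w => w = v) rfl (by simp))

theorem cell_empty (v : Fin n) : cell (∅ : Finset (Edge G)) v = {v} := by
  ext w
  rw [mem_cell_iff_rep, rep_empty, rep_empty, Finset.mem_singleton]

theorem forestSign_empty : forestSign (∅ : Finset (Edge G)) = 1 := by
  have hr : reps (∅ : Finset (Edge G)) = Finset.univ := by
    ext v
    simp [mem_reps, rep_empty]
  have h1 : orientation (∅ : Finset (Edge G)) =
      ((((Finset.univ : Finset (Fin n)).sort (· ≤ ·)).map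
        (fun v => (Pi.single v 1 : Fin n → ℤ))).map (ExteriorAlgebra.ι ℤ)).prod := by
    rw [orientation, hr, sortProd, sortProd, List.map_map]
    simp
    rfl
  rw [forestSign, h1, detForm_list_prod _ (by simp), ← Matrix.det_one (n := Fin n)]
  congr 1
  ext i j
  have : ∀ (i : ℕ) (hi : i < n), ((Finset.univ : Finset (Fin n)).sort (· ≤ ·))[i]'(by simpa) =
      ⟨i, hi⟩ := by
    intro i hi
    simp [Fin.sort_univ]
  simp [this, Matrix.one_apply, Pi.single_apply, eq_comm]

theorem exists_ordered_reps (hG : G.IsAcyclic) (s : Finset (Edge G)) (α : Edge G) :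
    ∃ m₁ m₂ : Fin n, ∃ e : ZMod 2, m₁ < m₂ ∧
      ((e = 0 ∧ rep (s.erase α) α.tail = m₁ ∧ rep (s.erase α) α.head = m₂) ∨
        (e = 1 ∧ rep (s.erase α) α.tail = m₂ ∧ rep (s.erase α) α.head = m₁)) := by
  rcases lt_or_gt_of_ne (fun H => not_linked_of_notMem hG (Finset.notMem_erase α s)
    (rep_eq_rep_iff.1 H)) with H | H
  · exact ⟨_, _, 0, H, Or.inl ⟨rfl, rfl, rfl⟩⟩
  · exact ⟨_, _, 1, H, Or.inr ⟨rfl, rfl, rfl⟩⟩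

theorem card_reps_add_card (hG : G.IsAcyclic) (s : Finset (Edge G)) :
    (reps s).card + s.card = n := by
  induction s using Finset.induction_on with
  | empty =>
    have hr : reps (∅ : Finset (Edge G)) = Finset.univ := by
      ext v
      simp [mem_reps, rep_empty]
    simp [hr]
  | insert α s hαs ih =>
    have hα : α ∈ insert α s := Finset.mem_insert_self _ _
    obtain ⟨m₁, m₂, e, h₁₂, hm⟩ := exists_ordered_reps hG (insert α s) α
    have hr := reps_eq_erase hα h₁₂ (hm.imp And.right And.right)
    rw [Finset.erase_insert hαs] at hr hm
    have hm2 : m₂ ∈ reps s := by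
      rw [mem_reps]
      rcases hm with ⟨-, -, rfl⟩ | ⟨-, rfl, -⟩ <;> exact rep_rep _ _
    have := Finset.card_pos.2 ⟨m₂, hm2⟩
    rw [hr, Finset.card_erase_of_mem hm2, Finset.card_insert_of_notMem hαs]
    omega

theorem reps_univ (hG : G.Connected) (v : Fin n) :
    reps (Finset.univ : Finset (Edge G)) = {rep (Finset.univ : Finset (Edge G)) v} := by
  ext w
  rw [mem_reps, Finset.mem_singleton]
  constructor
  · intro H
    rw [← H]
    exact rep_eq_rep_iff.2 (linked_of_reachable (hG.preconnected w v))
  · rintro rfl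
    exact rep_rep _ _

theorem card_edge (hG : G.IsTree) : Fintype.card (Edge G) + 1 = n := by
  obtain ⟨v⟩ := hG.connected.nonempty
  have hr := reps_univ hG.connected v
  have := card_reps_add_card hG.isAcyclic (Finset.univ : Finset (Edge G))
  rw [hr, Finset.card_singleton, Finset.card_univ] at this
  omega

/-- For a tree, the base vertex in the orientation may be moved to the last vertex, and expanding
the determinant along its row gives the sign of the tree. -/
theorem forestSign_univ (hG : G.IsTree) :
    forestSign (Finset.univ : Finset (Edge G)) = treeSign G := by
  have hcard := card_edge hG
  obtain ⟨m, rfl⟩ : ∃ m, n = m + 1 := ⟨_, hcard.symm⟩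
  have hcard' : Fintype.card (Edge G) = m := by omega
  have hr := reps_univ hG.connected (Fin.last m)
  set l : List (Fin (m + 1) → ℤ) :=
    ((Finset.univ : Finset (Edge G)).sort (· ≤ ·)).map edgeVec ++ [Pi.single (Fin.last m) 1] with hl
  have hlen : l.length = m + 1 := by simp [hl, hcard']
  have hlast : l[m]'(by omega) = Pi.single (Fin.last m) 1 := by
    have : m = (((Finset.univ : Finset (Edge G)).sort (· ≤ ·)).map edgeVec).length := by
      simp [hcard']
    simp only [hl]
    rw [List.getElem_append_right (by omega)]
    simp
  have h1 : orientation (Finset.univ : Finset (Edge G)) =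
      (l.map (ExteriorAlgebra.ι ℤ)).prod := by
    have h2 : orientation (Finset.univ : Finset (Edge G)) = sortProd edgeVec (Finset.univ : Finset (Edge G)) *
        ExteriorAlgebra.ι ℤ (Pi.single (rep (Finset.univ : Finset (Edge G)) (Fin.last m)) 1) := by
      rw [orientation, hr, sortProd, sortProd, Finset.sort_singleton]
      simp
    have h3 : (l.map (ExteriorAlgebra.ι ℤ)).prod = sortProd edgeVec (Finset.univ : Finset (Edge G)) *
        ExteriorAlgebra.ι ℤ (Pi.single (Fin.last m) 1 : Fin (m + 1) → ℤ) := by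
      rw [hl, List.map_append, List.prod_append, List.map_map, sortProd]
      simp
      rfl
    have h4 := ι_mul_sortProd_eq_zero (edgeVec (G := G)) (s := Finset.univ)
      (single_sub_single_mem_span (linked_rep (Finset.univ : Finset (Edge G)) (Fin.last m)))
    rw [ι_mul_sortProd] at h4
    have h5 := congrArg (fun z => sgn ℤ ((Finset.univ : Finset (Edge G)).card : ZMod 2) • z) h4
    simp only [smul_smul, sgn_mul_self, one_smul, smul_zero, map_sub, mul_sub] at h5
    rw [h2, h3, ← sub_eq_zero, h5]
  rw [forestSign, h1, detForm_list_prod l hlen, Matrix.det_succ_row _ (Fin.last m),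
    Finset.sum_eq_single (Fin.last m)]
  · simp only [Matrix.of_apply, Fin.val_last, hlast, Pi.single_eq_same, mul_one]
    rw [← two_mul, pow_mul, neg_one_sq, one_pow, one_mul, treeSign]
    congr 1
    ext i j
    have hi : (i : ℕ) < ((Finset.univ : Finset (Edge G)).sort (· ≤ ·)).length := by
      simp [hcard']
    have hi' : l[(i : ℕ)]'(by omega) =
        edgeVec (((Finset.univ : Finset (Edge G)).sort (· ≤ ·))[(i : ℕ)]'hi) := by
      simp only [hl]
      rw [List.getElem_append_left (by simpa using hi), List.getElem_map]
    simp only [Matrix.submatrix_apply, Matrix.of_apply, Fin.succAbove_last, Fin.val_castSucc, hi',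
      List.getElem?_eq_getElem hi, Option.elim_some]
    generalize ((Finset.univ : Finset (Edge G)).sort (· ≤ ·))[(i : ℕ)]'hi = α
    have hne := α.tail_lt_head.ne
    rw [edgeVec, Pi.sub_apply, Pi.single_apply, Pi.single_apply]
    have e1 : ∀ v : Fin (m + 1), (j.castSucc = v) ↔ ((j : ℕ) = (v : ℕ)) := by
      intro v
      rw [Fin.ext_iff, Fin.val_castSucc]
    simp only [e1]
    split_ifs with h6 h7 h7
    · exact absurd (Fin.ext (h7.symm.trans h6)) hne
    · simp
    · simp
    · simp
  · intro j _ hj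
    simp [hlast, hj]
  · simp

end OrientationSign

/-! ### The sign of a forest in the transferred products -/

section ForestExponent

variable {V : Type*} [Fintype V] [LinearOrder V]

/-- `1` off the fixed points of `ρ`, and `0` on them. -/
def offset (ρ : V → V) (v : V) : ZMod 2 := if ρ v = v then 0 else 1

/-- The contribution of the pair `(v, w)` to `forestExp`. -/
def pairExp (k : V → ℤ) (ρ : V → V) (v w : V) : ZMod 2 :=
  (if v < w then
    if ρ v = ρ w then 1 else if ρ w < ρ v then 1 + (k v : ZMod 2) * (k w : ZMod 2) else 0
    else 0) + if ρ v < ρ w then offset ρ w * ((k v : ZMod 2) + 1) else 0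

/-- The exponent of the sign with which a tensor product of operations on the blocks of a
partition of `V` acts on elements of degrees `k v`. The partition is given by the map `ρ` to the
smallest element of each block, and the blocks are ordered by these elements. A pair inside a
block contributes `1`; a pair which has to be transposed to sort the blocks contributes the sign
of the transposition and the Koszul sign; an operation, of degree `1` minus the size of its block,
which passes an element contributes the Koszul sign for degrees shifted by one. -/
def forestExp (k : V → ℤ) (ρ : V → V) : ZMod 2 := ∑ v, ∑ w, pairExp k ρ v w

omit [LinearOrder V] in
theorem sum_sum_eq_of_symm_diff {M : Type*} [AddCommMonoid M] (p : V → Prop) [DecidablePred p]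
    (F : V → V → M) (hF : ∀ v w, (p v ↔ p w) → F v w = 0) :
    ∑ v, ∑ w, F v w = ∑ v, ∑ w, if ¬ p v ∧ p w then F v w + F w v else 0 := by
  have e : ∀ v w, F v w = (if ¬ p v ∧ p w then F v w else 0) + if ¬ p w ∧ p v then F v w else 0 := by
    intro v w
    by_cases hv : p v <;> by_cases hw : p w <;> simp [hv, hw]
    · exact hF v w (by simp [hv, hw])
    · exact hF v w (by simp [hv, hw])
  rw [Finset.sum_congr rfl fun v _ => Finset.sum_congr rfl fun w _ => e v w]
  simp_rw [Finset.sum_add_distrib]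
  rw [Finset.sum_comm (f := fun v w => if ¬ p w ∧ p v then F v w else 0)]
  simp_rw [← Finset.sum_add_distrib]
  refine Finset.sum_congr rfl fun v _ => Finset.sum_congr rfl fun w _ => ?_
  split_ifs <;> simp

variable (k : V → ℤ) {ρ ρ' : V → V} {m₁ m₂ : V} (h₁₂ : m₁ < m₂) (h₁ : ρ m₁ = m₁)
  (h₂ : ρ m₂ = m₂) (hρ' : ∀ v, ρ' v = if ρ v = m₂ then m₁ else ρ v)

omit [Fintype V] in
include hρ' in
theorem pairExp_add_pairExp_of_iff {v w : V} (hvw : ρ v = m₂ ↔ ρ w = m₂) :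
    pairExp k ρ' v w + pairExp k ρ v w = 0 := by
  by_cases hv : ρ v = m₂
  · have hw := hvw.1 hv
    simp only [pairExp, hρ', hv, hw, if_true, lt_irrefl, if_false, add_zero]
    exact CharTwo.add_self_eq_zero _
  · have hw : ρ w ≠ m₂ := fun H => hv (hvw.2 H)
    have e : offset ρ' w = offset ρ w := by simp only [offset, hρ', hw, if_false]
    simp only [pairExp, hρ', hv, hw, if_false, e]
    exact CharTwo.add_self_eq_zero _

omit [Fintype V] in
include h₁ hρ' h₁₂ in
/-- The change of `pairExp` at a pair of which only the second element lies in the block of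
`m₂`, when the block of `m₂` is joined to that of `m₁`. -/
theorem pairExp_join {v w : V} (hv : ρ v ≠ m₂) (hw : ρ w = m₂) :
    (pairExp k ρ' v w + pairExp k ρ v w) + (pairExp k ρ' w v + pairExp k ρ w v) =
      if ρ v < m₁ then (1 + offset ρ w) * (k v + 1)
      else if ρ v = m₁ then offset ρ w * k v + (1 + offset ρ w) +
        if w < v then 1 + (k v : ZMod 2) * (k w : ZMod 2) else 0
      else if ρ v < m₂ then 1 + (k v : ZMod 2) * (k w : ZMod 2) + offset ρ w * (k v + 1) +
        offset ρ v * (k w + 1)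
      else 0 := by
  have hvw : v ≠ w := by
    rintro rfl
    exact hv hw
  have e1 : offset ρ' v = offset ρ v := by simp only [offset, hρ', hv, if_false]
  have e2 : offset ρ' w = 1 := by
    rw [offset, hρ', if_pos hw, if_neg]
    rintro rfl
    exact h₁₂.ne (h₁.symm.trans hw)
  simp only [pairExp, hρ', hv, hw, if_false, if_true, e1, e2]
  generalize offset ρ v = a
  generalize offset ρ w = b
  generalize (k v : ZMod 2) = c
  generalize (k w : ZMod 2) = d
  have hne2 : m₂ ≠ ρ v := fun H => hv H.symm
  rcases lt_trichotomy (ρ v) m₁ with h3 | h3 | h3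
  · have h4 := h3.trans h₁₂
    rcases lt_or_gt_of_ne hvw with h5 | h5 <;>
      simp only [h3, h4, h5, h3.not_gt, h4.not_gt, h5.not_gt, h3.ne, h3.ne', h4.ne',
        if_true, if_false] <;> revert a b c d <;> decide
  · subst h3
    rcases lt_or_gt_of_ne hvw with h5 | h5 <;>
      simp only [h₁₂, h5, h₁₂.not_gt, h5.not_gt, h₁₂.ne', lt_irrefl,
        if_true, if_false] <;> revert a b c d <;> decide
  · rcases lt_or_gt_of_ne hv with h4 | h4
    · rcases lt_or_gt_of_ne hvw with h5 | h5 <;>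
        simp only [h3, h4, h5, h3.not_gt, h4.not_gt, h5.not_gt, h3.ne, h3.ne', h4.ne',
          if_true, if_false] <;> revert a b c d <;> decide
    · rcases lt_or_gt_of_ne hvw with h5 | h5 <;>
        simp only [h3, h4, h5, h3.not_gt, h4.not_gt, h5.not_gt, h3.ne, h3.ne', h4.ne,
          if_true, if_false] <;> revert a b c d <;> decide

theorem sum_one_add_offset {m : V} (hm : ρ m = m) :
    (∑ v, if ρ v = m then 1 + offset ρ v else 0) = 1 := by
  rw [Finset.sum_eq_single m]
  · simp [offset, hm]
  · intro v _ hv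
    have h2 : (1 + 1 : ZMod 2) = 0 := by decide
    split_ifs with h
    · rw [offset, if_neg (fun H => hv (H.symm.trans h)), h2]
    · rfl
  · simp

include h₁ h₂ hρ' h₁₂ in
/-- The change of `forestExp` when the block of `m₂` is joined to that of `m₁`: it consists of
the Koszul sign for moving the operation of the second block to the first, the sign of the cut of
the joined block, the number of blocks before the second one, and the Koszul sign for moving a
new operation past the blocks before the first one. -/
theorem forestExp_join :
    forestExp k ρ' + forestExp k ρ +
      (∑ v, ∑ w, if (m₁ < ρ v ∧ ρ v < m₂) ∧ ρ w = m₂ then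
        (k v + offset ρ v) * (k w + offset ρ w) else 0) +
      (∑ v, if ρ v < m₂ then 1 + offset ρ v else 0) +
      (∑ v, if ρ v < m₁ then k v + offset ρ v else 0) =
    cutExp k (Finset.univ.filter fun v => ρ v = m₁) (Finset.univ.filter fun v => ρ v = m₂) := by
  have hs1 := sum_one_add_offset h₁
  have hs2 := sum_one_add_offset h₂
  have A : forestExp k ρ' + forestExp k ρ = ∑ v, ∑ w, if ρ v ≠ m₂ ∧ ρ w = m₂ then
      (if ρ v < m₁ then (1 + offset ρ w) * (k v + 1)
      else if ρ v = m₁ then offset ρ w * k v + (1 + offset ρ w) +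
        if w < v then 1 + (k v : ZMod 2) * (k w : ZMod 2) else 0
      else if ρ v < m₂ then 1 + (k v : ZMod 2) * (k w : ZMod 2) + offset ρ w * (k v + 1) +
        offset ρ v * (k w + 1)
      else 0) else 0 := by
    rw [forestExp, forestExp, ← Finset.sum_add_distrib]
    simp_rw [← Finset.sum_add_distrib]
    rw [sum_sum_eq_of_symm_diff (fun v => ρ v = m₂) _ fun v w hvw =>
      pairExp_add_pairExp_of_iff k hρ' hvw]
    refine Finset.sum_congr rfl fun v _ => Finset.sum_congr rfl fun w _ => ?_
    by_cases H : ρ v ≠ m₂ ∧ ρ w = m₂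
    · rw [if_pos H, if_pos H, pairExp_join k h₁₂ h₁ hρ' H.1 H.2]
    · rw [if_neg H, if_neg H]
  have hcard : ((Finset.univ.filter fun v => ρ v = m₂).card : ZMod 2) =
      (∑ w, if ρ w = m₂ then offset ρ w else 0) + 1 := by
    rw [← hs2, ← Finset.sum_add_distrib, Finset.card_eq_sum_ones, Finset.sum_filter]
    push_cast
    refine Finset.sum_congr rfl fun w _ => ?_
    generalize offset ρ w = a
    split_ifs <;> revert a <;> decide
  have B : ∀ v, (∑ w, if ρ v ≠ m₂ ∧ ρ w = m₂ then
      (if ρ v < m₁ then (1 + offset ρ w) * ((k v : ZMod 2) + 1)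
      else if ρ v = m₁ then offset ρ w * k v + (1 + offset ρ w) +
        if w < v then 1 + (k v : ZMod 2) * (k w : ZMod 2) else 0
      else if ρ v < m₂ then 1 + (k v : ZMod 2) * (k w : ZMod 2) + offset ρ w * (k v + 1) +
        offset ρ v * (k w + 1)
      else 0) else 0) +
      (∑ w, if (m₁ < ρ v ∧ ρ v < m₂) ∧ ρ w = m₂ then
        ((k v : ZMod 2) + offset ρ v) * (k w + offset ρ w) else 0) +
      (if ρ v < m₂ then 1 + offset ρ v else 0) +
      (if ρ v < m₁ then k v + offset ρ v else 0) =
      if ρ v = m₁ then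
        ((1 : ZMod 2) + (((Finset.univ.filter fun v => ρ v = m₂).card : ZMod 2) + 1) * k v +
        ∑ w ∈ Finset.univ.filter fun v => ρ v = m₂,
          if w < v then 1 + (k v : ZMod 2) * (k w : ZMod 2) else 0) + (1 + offset ρ v) else 0 := by
    intro v
    rw [← Finset.sum_add_distrib]
    rcases lt_trichotomy (ρ v) m₁ with h3 | h3 | h3
    · have h4 := h3.trans h₁₂
      have : ∀ w, ((if ρ w = m₂ then (1 + offset ρ w) * ((k v : ZMod 2) + 1) else 0) =
          (if ρ w = m₂ then 1 + offset ρ w else 0) * ((k v : ZMod 2) + 1)) := fun w => by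
        split_ifs <;> simp
      simp only [h3, h4, h3.not_gt, h3.ne, h4.ne, if_true, if_false, ne_eq, not_false_eq_true,
        true_and, false_and, add_zero, this, ← Finset.sum_mul, hs2]
      generalize offset ρ v = a
      generalize (k v : ZMod 2) = c
      revert a c
      decide
    · have : ∀ w, ((if ρ w = m₂ then offset ρ w * (k v : ZMod 2) + (1 + offset ρ w) +
          (if w < v then 1 + (k v : ZMod 2) * (k w : ZMod 2) else 0) else 0) =
          (if ρ w = m₂ then offset ρ w else 0) * (k v : ZMod 2) +
          (if ρ w = m₂ then 1 + offset ρ w else 0) +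
          if ρ w = m₂ then (if w < v then 1 + (k v : ZMod 2) * (k w : ZMod 2) else 0) else 0) :=
        fun w => by split_ifs <;> simp
      simp only [h3, h₁₂, h₁₂.ne, lt_irrefl, if_true, if_false, ne_eq, not_false_eq_true,
        true_and, false_and, add_zero, this, Finset.sum_add_distrib, ← Finset.sum_mul, hs2, hcard,
        ← Finset.sum_filter]
      have h2 : (1 + 1 : ZMod 2) = 0 := by decide
      linear_combination (-(k v : ZMod 2)) * h2
    · rcases lt_trichotomy (ρ v) m₂ with h4 | h4 | h4
      · have : ∀ w, ((if ρ w = m₂ then 1 + (k v : ZMod 2) * (k w : ZMod 2) +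
            offset ρ w * ((k v : ZMod 2) + 1) + offset ρ v * ((k w : ZMod 2) + 1) else 0) +
            (if ρ w = m₂ then ((k v : ZMod 2) + offset ρ v) * (k w + offset ρ w) else 0) =
            (if ρ w = m₂ then 1 + offset ρ w else 0) * (1 + offset ρ v)) := fun w => by
          generalize offset ρ v = a
          generalize offset ρ w = b
          generalize (k v : ZMod 2) = c
          generalize (k w : ZMod 2) = d
          split_ifs <;> revert a b c d <;> decide
        simp only [h3, h4, h3.not_gt, h3.ne', h4.ne, if_true, if_false, ne_eq, not_false_eq_true,
          true_and, and_self, add_zero, this, ← Finset.sum_mul, hs2]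
        rw [one_mul, CharTwo.add_self_eq_zero]
      · simp [h4, h₁₂.not_gt, h₁₂.ne']
      · simp [h3.not_gt, h3.ne', h4.not_gt]
  rw [A, ← Finset.sum_add_distrib, ← Finset.sum_add_distrib, ← Finset.sum_add_distrib,
    Finset.sum_congr rfl fun v _ => B v]
  have C : ∀ v, ∀ y : ZMod 2, (if ρ v = m₁ then y + (1 + offset ρ v) else 0) =
      (if ρ v = m₁ then y else 0) + if ρ v = m₁ then 1 + offset ρ v else 0 := fun v y => by
    split_ifs <;> simp
  simp only [C]
  rw [Finset.sum_add_distrib, hs1, ← Finset.sum_filter, Finset.sum_add_distrib,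
    Finset.sum_add_distrib, cutExp, crossInv, Finset.mul_sum]
  simp only [Finset.sum_const, nsmul_eq_mul, mul_one]
  ring

end ForestExponent

/-! ### Merging two blocks of a tensor product of operations -/

section Merge

theorem intCast_sgn (R : Type*) [CommRing R] (x : ZMod 2) : ((sgn ℤ x : ℤ) : R) = sgn R x := by
  unfold sgn
  split_ifs <;> simp

theorem fibreList_eq_singleton {ι κ : Type*} [Fintype ι] [LinearOrder ι] [DecidableEq κ]
    {φ : ι → κ} {y : κ} {i : ι} (hi : ∀ j, φ j = y ↔ j = i) : fibreList φ y = [i] := by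
  rw [fibreList, ← Finset.sort_singleton (· ≤ ·) i]
  congr 1
  ext j
  simp [hi]

theorem fibreList_eq_pair {ι κ : Type*} [Fintype ι] [LinearOrder ι] [DecidableEq κ]
    {φ : ι → κ} {y : κ} {i₁ i₂ : ι} (h₁₂ : i₁ < i₂) (hi : ∀ j, φ j = y ↔ j = i₁ ∨ j = i₂) :
    fibreList φ y = [i₁, i₂] := by
  have e : (Finset.univ.filter fun j => φ j = y) = insert i₁ {i₂} := by
    ext j
    simp [hi]
  rw [fibreList, e, Finset.sort_insert _ (by simp [h₁₂.le]) (by simp [h₁₂.ne]),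
    Finset.sort_singleton]

variable {n : ℕ} {G : SimpleGraph (Fin n)} (k : Fin n → ℤ)

/-- The degree of the operation on the component of `v` in `[G : s]`, on elements of degrees
`k`. -/
def cellDeg (s : Finset (Edge G)) (v : Fin n) : ℤ := (∑ w ∈ cell s v, k w) + 1 - (cell s v).card

theorem cell_eq_filter (s : Finset (Edge G)) (v : Fin n) :
    cell s v = Finset.univ.filter fun w => rep s w = rep s v := by
  ext w
  rw [mem_cell_iff_rep]
  simp

theorem cellDeg_cast (s : Finset (Edge G)) (v : Fin n) :
    (cellDeg k s v : ZMod 2) =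
      ∑ w, if rep s w = rep s v then (k w : ZMod 2) + offset (rep s) w else 0 := by
  have h1 := sum_one_add_offset (ρ := rep s) (rep_rep s v)
  rw [← Finset.sum_filter, Finset.sum_add_distrib, ← cell_eq_filter] at h1 ⊢
  rw [Finset.sum_const, nsmul_one] at h1
  rw [cellDeg]
  push_cast
  rw [← h1]
  ring

/-- Sums over the components of `[G : s]` as sums over the vertices. -/
theorem sum_comp_mul_cellDeg (s : Finset (Edge G)) (F : Fin n → ZMod 2) :
    ∑ c : Comp s, F c.1 * (cellDeg k s c.1 : ZMod 2) =
      ∑ v, F (rep s v) * ((k v : ZMod 2) + offset (rep s) v) := by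
  rw [← Finset.sum_fiberwise Finset.univ (compOf s)]
  refine Finset.sum_congr rfl fun c _ => ?_
  rw [cellDeg_cast, Finset.mul_sum, Finset.sum_filter]
  refine Finset.sum_congr rfl fun v _ => ?_
  have e : compOf s v = c ↔ rep s v = c.1 := by
    rw [Subtype.ext_iff]; rfl
  rw [rep_coe]
  by_cases H : rep s v = c.1
  · rw [if_pos H, if_pos (e.2 H), H]
  · rw [if_neg H, if_neg (fun K => H (e.1 K)), mul_zero]

theorem sum_comp_ite_cellDeg (s : Finset (Edge G)) (p : Fin n → Prop) [DecidablePred p] :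
    (∑ c : Comp s, if p c.1 then (cellDeg k s c.1 : ZMod 2) else 0) =
      ∑ v, if p (rep s v) then (k v : ZMod 2) + offset (rep s) v else 0 := by
  have := sum_comp_mul_cellDeg k s fun v => if p v then 1 else 0
  simpa only [ite_mul, one_mul, zero_mul] using this

theorem card_reps_filter (s : Finset (Edge G)) (m : Fin n) :
    ((((reps s).filter (· < m)).card : ℕ) : ZMod 2) =
      ∑ v, if rep s v < m then 1 + offset (rep s) v else 0 := by
  rw [Finset.card_eq_sum_ones, reps, Finset.filter_filter, Finset.sum_filter]
  push_cast
  refine Finset.sum_congr rfl fun v _ => ?_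
  have h2 : (1 + 1 : ZMod 2) = 0 := by decide
  by_cases H : rep s v = v
  · simp [offset, H]
  · simp [offset, H, h2]

variable {R : Type*} [CommRing R] {B : Type*} [Ring B] [Algebra R B]
  (𝒜 : ℤ → Submodule R B) [GradedAlgebra 𝒜] (h : B →ₗ[R] B) (x : Fin n → B)

/-- The operation `hλ`, summed over linear extensions, on the component `c` of `[G : s]`. -/
def block (s : Finset (Edge G)) (c : Comp s) : B := hLamSum 𝒜 h (edgeRel G) x k (cell s c.1)

variable (R) in
/-- The coefficient of the tensor product of the operations on the components of `[G : s]` in the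
element of the graph complex produced by `|s|` steps. -/
def forestCoeff (s : Finset (Edge G)) : R :=
  sgn R (s.card + forestExp k (rep s)) * (forestSign s : R)

variable (hx : ∀ v, x v ∈ 𝒜 (k v)) (hh : ∀ i, ∀ y ∈ 𝒜 i, h y ∈ 𝒜 (i - 1))
  (hcomm : ∀ i j, ∀ y ∈ 𝒜 i, ∀ z ∈ 𝒜 j, y * z = (i * j).negOnePow • (z * y))

include hx hh in
theorem block_mem (s : Finset (Edge G)) (c : Comp s) :
    block k 𝒜 h x s c ∈ 𝒜 (cellDeg k s c.1) :=
  hLamSum_mem 𝒜 h (edgeRel G) x k hx hh ⟨_, self_mem_cell _ _⟩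

/-- The multiplication along an edge which joins the components of `m₁ < m₂` multiplies the two
corresponding blocks, and leaves the other ones alone. -/
theorem fibreList_block {s : Finset (Edge G)} {α : Edge G} (hα : α ∈ s)
    {c₁ c₂ : Comp (s.erase α)} (h₁₂ : c₁ < c₂)
    (hm : (rep (s.erase α) α.tail = c₁.1 ∧ rep (s.erase α) α.head = c₂.1) ∨
      (rep (s.erase α) α.tail = c₂.1 ∧ rep (s.erase α) α.head = c₁.1)) :
    (fun y => ((fibreList (fun c : Comp (s.erase α) => compOf s c.1) y).map
      (block k 𝒜 h x (s.erase α))).prod) =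
      Function.update (block k 𝒜 h x s) (compOf s α.tail)
        (block k 𝒜 h x (s.erase α) c₁ * block k 𝒜 h x (s.erase α) c₂) := by
  have h₁₂' : c₁.1 < c₂.1 := h₁₂
  have hrep := rep_eq_ite hα h₁₂' hm
  have htail : rep s α.tail = c₁.1 := by
    rw [hrep]
    rcases hm with ⟨H, -⟩ | ⟨H, -⟩ <;> simp [H]
  have hrc : ∀ c : Comp (s.erase α), rep s c.1 = if c.1 = c₂.1 then c₁.1 else c.1 := fun c => by
    rw [hrep, rep_coe]
  have hφ : ∀ (c : Comp (s.erase α)) (y : Comp s), compOf s c.1 = y ↔ rep s c.1 = y.1 :=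
    fun c y => by rw [Subtype.ext_iff]; rfl
  funext y
  by_cases hy : y = compOf s α.tail
  · subst hy
    rw [Function.update_self, fibreList_eq_pair h₁₂]
    · simp
    · intro c
      rw [hφ, hrc, Subtype.ext_iff, Subtype.ext_iff]
      change _ = rep s α.tail ↔ _
      rw [htail]
      split_ifs with H
      · simp [H]
      · simp [H]
  · rw [Function.update_of_ne hy]
    have hy1 : y.1 ≠ c₁.1 := fun H => hy (Subtype.ext (H.trans htail.symm))
    have hy2 := rep_coe y
    rw [hrep] at hy2
    have hy3 : rep (s.erase α) y.1 = y.1 := by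
      split_ifs at hy2 with H
      · exact absurd hy2.symm hy1
      · exact hy2
    have hy4 : y.1 ≠ c₂.1 := by
      intro H
      rw [H, rep_coe, if_pos rfl] at hy2
      exact h₁₂'.ne hy2
    obtain ⟨c, hc⟩ : ∃ c : Comp (s.erase α), c.1 = y.1 := ⟨⟨y.1, rep_eq_self_iff.1 hy3⟩, rfl⟩
    rw [fibreList_eq_singleton (i := c)]
    · rw [List.map_singleton, List.prod_singleton, block, block, hc]
      congr 1
      ext w
      rw [mem_cell_iff_rep, mem_cell_iff_rep, rep_coe, hy3, hrep]
      split_ifs with H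
      · rw [H]
        exact ⟨fun K => absurd K.symm hy4, fun K => absurd K.symm hy1⟩
      · rfl
    · intro c'
      rw [hφ, hrc, Subtype.ext_iff, hc]
      split_ifs with H
      · rw [H]
        exact ⟨fun K => absurd K.symm hy1, fun K => absurd K.symm hy4⟩
      · rfl

include hx hh hcomm in
/-- The product of the blocks at the two ends of the edge `α`, in terms of the cut product in
which the block of the tail comes first. -/
theorem block_mul_block {s : Finset (Edge G)} {α : Edge G}
    {c₁ c₂ : Comp s} (h₁₂ : c₁ < c₂) {e : ZMod 2}
    (hm : (e = 0 ∧ rep s α.tail = c₁.1 ∧ rep s α.head = c₂.1) ∨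
      (e = 1 ∧ rep s α.tail = c₂.1 ∧ rep s α.head = c₁.1)) :
    block k 𝒜 h x s c₁ * block k 𝒜 h x s c₂ =
      sgn R (cutExp k (cell s c₁.1) (cell s c₂.1) + e) •
        cutProd 𝒜 h (edgeRel G) x k (cell s α.tail) (cell s α.head) := by
  have hdisj : Disjoint (cell s c₁.1) (cell s c₂.1) := by
    rw [Finset.disjoint_left]
    intro v hv1 hv2
    rw [mem_cell_iff_rep, rep_coe] at hv1 hv2
    exact h₁₂.ne (Subtype.ext (hv1.symm.trans hv2))
  have hne₁ : (cell s c₁.1).Nonempty := ⟨_, self_mem_cell _ _⟩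
  have hne₂ : (cell s c₂.1).Nonempty := ⟨_, self_mem_cell _ _⟩
  have hcell : ∀ v, cell s v = cell s (rep s v) := fun v => cell_eq_of_linked (linked_rep _ _)
  have hp : block k 𝒜 h x s c₁ * block k 𝒜 h x s c₂ =
      sgn R (cutExp k (cell s c₁.1) (cell s c₂.1)) •
        cutProd 𝒜 h (edgeRel G) x k (cell s c₁.1) (cell s c₂.1) := by
    rw [cutProd, smul_smul, sgn_mul_self, one_smul]
    rfl
  rw [hp, sgn_add, mul_smul]
  congr 1
  rw [hcell α.tail, hcell α.head]
  rcases hm with ⟨rfl, ht, hd⟩ | ⟨rfl, ht, hd⟩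
  · rw [ht, hd, sgn_zero, one_smul]
  · rw [ht, hd, sgn_one, neg_smul, one_smul,
      cutProd_swap 𝒜 h (edgeRel G) x k hx hh hcomm hne₁ hne₂ hdisj]

variable (R) in
theorem koszulSign_compOf {s : Finset (Edge G)} {α : Edge G} (hα : α ∈ s)
    {c₁ c₂ : Comp (s.erase α)} (h₁₂ : c₁ < c₂)
    (hm : (rep (s.erase α) α.tail = c₁.1 ∧ rep (s.erase α) α.head = c₂.1) ∨
      (rep (s.erase α) α.tail = c₂.1 ∧ rep (s.erase α) α.head = c₁.1)) :
    ((koszulSign (fun c : Comp (s.erase α) => compOf s c.1)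
      (fun c => cellDeg k (s.erase α) c.1) : ℤ) : R) =
      sgn R (∑ v, ∑ w, if (c₁.1 < rep (s.erase α) v ∧ rep (s.erase α) v < c₂.1) ∧
        rep (s.erase α) w = c₂.1 then ((k v : ZMod 2) + offset (rep (s.erase α)) v) *
          (k w + offset (rep (s.erase α)) w) else 0) := by
  have h₁₂' : c₁.1 < c₂.1 := h₁₂
  have hrc : ∀ c : Comp (s.erase α), rep s c.1 = if c.1 = c₂.1 then c₁.1 else c.1 := fun c => by
    rw [rep_eq_ite hα h₁₂' hm, rep_coe]
  rw [koszulSign_eq_sgn]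
  congr 1
  have hs : ∀ (p q : Prop) [Decidable p] [Decidable q] (a b : ZMod 2),
      (if p ∧ q then a * b else 0) = (if p then a else 0) * (if q then b else 0) := by
    intro p q _ _ a b
    by_cases hp : p <;> by_cases hq : q <;> simp [hp, hq]
  simp only [hs (c₁.1 < _ ∧ _ < c₂.1)]
  rw [← Finset.sum_mul_sum, ← sum_comp_ite_cellDeg k (s.erase α) fun v => c₁.1 < v ∧ v < c₂.1,
    ← sum_comp_ite_cellDeg k (s.erase α) fun v => v = c₂.1, Finset.sum_mul_sum]
  refine Finset.sum_congr rfl fun c _ => Finset.sum_congr rfl fun c' _ => ?_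
  rw [← hs]
  refine if_congr ?_ rfl rfl
  change c.1 < c'.1 ∧ rep s c'.1 < rep s c.1 ↔ _
  rw [hrc, hrc]
  split_ifs with H H' H'
  · simp [H, H']
  · simp [H, and_comm]
  · simp only [H, and_false, iff_false, not_and, not_lt]
    intro H2
    rw [H'] at H2
    exact (h₁₂'.trans H2).le
  · simp only [H, and_false, iff_false, not_and, not_lt]
    exact le_of_lt

theorem edgeSign_erase (R : Type*) [CommRing R] (s : Finset (Edge G)) (α : Edge G) :
    ((edgeSign α (s.erase α) : ℤ) : R) = sgn R (((s.filter (· < α)).card : ℕ) : ZMod 2) := by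
  have e1 : (s.erase α).filter (· < α) = s.filter (· < α) := by
    ext β
    simp only [Finset.mem_filter, Finset.mem_erase]
    exact ⟨fun H => ⟨H.1.2, H.2⟩, fun H => ⟨⟨H.2.ne, H.1⟩, H.2⟩⟩
  rw [edgeSign, e1, sgn_natCast]
  push_cast
  rfl

variable (R) in
/-- The signs which occur when the edge `α` is added multiply to the ratio of the coefficients of
the two forests, up to the Koszul sign for moving a new operation past the preceding blocks. -/
theorem sgn_mul_forestCoeff_erase {s : Finset (Edge G)} {α : Edge G} (hα : α ∈ s)
    {c₁ c₂ : Comp (s.erase α)} (h₁₂ : c₁ < c₂) {e : ZMod 2}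
    (hm : (e = 0 ∧ rep (s.erase α) α.tail = c₁.1 ∧ rep (s.erase α) α.head = c₂.1) ∨
      (e = 1 ∧ rep (s.erase α) α.tail = c₂.1 ∧ rep (s.erase α) α.head = c₁.1)) :
    sgn R (((s.filter (· < α)).card : ℕ) : ZMod 2) * forestCoeff k R (s.erase α) *
      sgn R (∑ v, ∑ w, if (c₁.1 < rep (s.erase α) v ∧ rep (s.erase α) v < c₂.1) ∧
        rep (s.erase α) w = c₂.1 then ((k v : ZMod 2) + offset (rep (s.erase α)) v) *
          (k w + offset (rep (s.erase α)) w) else 0) *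
      sgn R (cutExp k (cell (s.erase α) c₁.1) (cell (s.erase α) c₂.1) + e) =
      sgn R (s.card + ∑ v, if rep s v < rep s α.tail then (k v : ZMod 2) + offset (rep s) v
        else 0) * forestCoeff k R s := by
  have h₁₂' : c₁.1 < c₂.1 := h₁₂
  have hm' := hm.imp And.right And.right
  have hrep := rep_eq_ite hα h₁₂' hm'
  have htail : rep s α.tail = c₁.1 := by
    rw [hrep]
    rcases hm' with ⟨H, -⟩ | ⟨H, -⟩ <;> simp [H]
  have hbelow : (∑ v, if rep s v < rep s α.tail then (k v : ZMod 2) + offset (rep s) v else 0) =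
      ∑ v, if rep (s.erase α) v < c₁.1 then
        (k v : ZMod 2) + offset (rep (s.erase α)) v else 0 := by
    refine Finset.sum_congr rfl fun v _ => ?_
    rw [htail, offset, offset, hrep v]
    by_cases H : rep (s.erase α) v = c₂.1
    · simp [H, h₁₂'.not_gt]
    · simp only [H, if_false]
  have hjoin := forestExp_join k h₁₂' (rep_coe c₁) (rep_coe c₂) hrep
  have hcell : ∀ c : Comp (s.erase α),
      cell (s.erase α) c.1 = Finset.univ.filter (fun v => rep (s.erase α) v = c.1) := fun c => by
    rw [cell_eq_filter, rep_coe]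
  rw [hbelow, forestCoeff, forestCoeff, forestSign_eq hα h₁₂' hm, Int.cast_mul, intCast_sgn,
    hcell, hcell, ← hjoin, card_reps_filter]
  generalize (∑ v, ∑ w, if (c₁.1 < rep (s.erase α) v ∧ rep (s.erase α) v < c₂.1) ∧
    rep (s.erase α) w = c₂.1 then ((k v : ZMod 2) + offset (rep (s.erase α)) v) *
      (k w + offset (rep (s.erase α)) w) else 0) = a
  generalize (∑ v, if rep (s.erase α) v < c₁.1 then
    (k v : ZMod 2) + offset (rep (s.erase α)) v else 0) = b
  generalize (∑ v, if rep (s.erase α) v < c₂.1 then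
    1 + offset (rep (s.erase α)) v else 0) = c
  generalize forestExp k (rep (s.erase α)) = p
  generalize forestExp k (rep s) = q
  generalize (((s.filter (· < α)).card : ℕ) : ZMod 2) = r
  generalize ((s.erase α).card : ZMod 2) = t
  generalize (s.card : ZMod 2) = u
  calc _ = sgn R (r + (t + p) + a + (q + p + a + c + b + e)) *
        (forestSign (s.erase α) : R) := by simp only [sgn_add]; ring
    _ = sgn R ((u + b) + (u + q) + (r + t + c + e)) * (forestSign (s.erase α) : R) := by
        have h20 : (2 : ZMod 2) = 0 := by decide
        congr 2
        linear_combination (p + a - u) * h20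
    _ = _ := by simp only [sgn_add]; ring

include hx hh hcomm in
/-- The effect of the summand of the graph differential which adds the edge `α` on the tensor
product of the operations on components: the two components which `α` joins are replaced by a
cut product. -/
theorem koszulMul_block (hG : G.IsAcyclic) {s : Finset (Edge G)} {α : Edge G} (hα : α ∈ s) :
    ((edgeSign α (s.erase α) : ℤ) : R) • koszulMul 𝒜
        (fun c : Comp (s.erase α) => compOf s c.1)
        (forestCoeff k R (s.erase α) • PiTensorProduct.tprod R (block k 𝒜 h x (s.erase α))) =
      (sgn R (s.card + ∑ v, if rep s v < rep s α.tail then (k v : ZMod 2) + offset (rep s) v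
        else 0) * forestCoeff k R s) •
        PiTensorProduct.tprod R (Function.update (block k 𝒜 h x s) (compOf s α.tail)
          (cutProd 𝒜 h (edgeRel G) x k (cell (s.erase α) α.tail) (cell (s.erase α) α.head))) := by
  obtain ⟨c₁, c₂, e, h₁₂, hm⟩ : ∃ c₁ c₂ : Comp (s.erase α), ∃ e : ZMod 2, c₁ < c₂ ∧
      ((e = 0 ∧ rep (s.erase α) α.tail = c₁.1 ∧ rep (s.erase α) α.head = c₂.1) ∨
        (e = 1 ∧ rep (s.erase α) α.tail = c₂.1 ∧ rep (s.erase α) α.head = c₁.1)) := by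
    obtain ⟨m₁, m₂, e, h₁₂, hm⟩ := exists_ordered_reps hG s α
    rcases hm with ⟨he, rfl, rfl⟩ | ⟨he, rfl, rfl⟩
    · exact ⟨compOf _ α.tail, compOf _ α.head, e, h₁₂, Or.inl ⟨he, rfl, rfl⟩⟩
    · exact ⟨compOf _ α.head, compOf _ α.tail, e, h₁₂, Or.inr ⟨he, rfl, rfl⟩⟩
  have hm' := hm.imp And.right And.right
  have h1 := koszulMul_tprod 𝒜 (fun c : Comp (s.erase α) => compOf s c.1)
    (fun c => cellDeg k (s.erase α) c.1) (block k 𝒜 h x (s.erase α))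
    (block_mem k 𝒜 h x hx hh (s.erase α))
  rw [fibreList_block k 𝒜 h x hα h₁₂ hm',
    block_mul_block k 𝒜 h x hx hh hcomm h₁₂ hm, MultilinearMap.map_update_smul,
    koszulSign_compOf k R hα h₁₂ hm', smul_smul] at h1
  rw [map_smul, h1, edgeSign_erase, smul_smul, smul_smul, ← mul_assoc,
    sgn_mul_forestCoeff_erase k R hα h₁₂ hm]

end Merge

/-! ### The iterated perturbation on the graph complex of a forest -/

section Iteration

variable {n : ℕ} {G : SimpleGraph (Fin n)} (k : Fin n → ℤ)
  {R : Type*} [CommRing R] {B : Type*} [Ring B] [Algebra R B]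
  (𝒜 : ℤ → Submodule R B) [GradedAlgebra 𝒜] {A : Type*} [AddCommGroup A] [Module R A]
  (f : B →ₗ[R] A) (g : A →ₗ[R] B) (h : B →ₗ[R] B) (a : Fin n → A)

theorem cell_eq_singleton {s : Finset (Edge G)} {c : Comp s} (hc : (cell s c.1).card < 2) :
    cell s c.1 = {c.1} := by
  refine (Finset.eq_of_subset_of_card_le ?_ ?_).symm
  · exact Finset.singleton_subset_iff.2 (self_mem_cell _ _)
  · rw [Finset.card_singleton]; omega

theorem block_of_card_lt_two {s : Finset (Edge G)} {c : Comp s} (x : Fin n → B)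
    (hc : (cell s c.1).card < 2) : block k 𝒜 h x s c = -x c.1 := by
  rw [block, cell_eq_singleton hc, hLamSum_singleton]

theorem two_le_card_cell {s : Finset (Edge G)} {α : Edge G} (hα : α ∈ s) :
    2 ≤ (cell s (compOf s α.tail).1).card := by
  have e : cell s (compOf s α.tail).1 = cell s α.tail :=
    (cell_eq_of_linked (linked_rep s α.tail)).symm
  have hsub : ({α.tail, α.head} : Finset (Fin n)) ⊆ cell s α.tail := by
    intro v hv
    rw [Finset.mem_insert, Finset.mem_singleton] at hv
    rcases hv with rfl | rfl
    · exact self_mem_cell _ _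
    · exact mem_cell.2 (linked_of_mem hα)
  rw [e, ← Finset.card_pair α.tail_lt_head.ne]
  exact Finset.card_le_card hsub

variable (hx : ∀ v, g (a v) ∈ 𝒜 (k v)) (hh : ∀ i, ∀ y ∈ 𝒜 i, h y ∈ 𝒜 (i - 1))
  (hcomm : ∀ i j, ∀ y ∈ 𝒜 i, ∀ z ∈ 𝒜 j, y * z = (i * j).negOnePow • (z * y))
  (fg : ∀ x, f (g x) = x) (hg : ∀ x, h (g x) = 0) (fh : ∀ x, f (h x) = 0)
  (hh0 : ∀ x, h (h x) = 0)

include hg hh0 in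
theorem h_block (s : Finset (Edge G)) (c : Comp s) :
    h (block k 𝒜 h (fun v => g (a v)) s c) = 0 := by
  rcases Nat.lt_or_ge (cell s c.1).card 2 with hc | hc
  · rw [block_of_card_lt_two k 𝒜 h _ hc, map_neg, hg, neg_zero]
  · rw [block, hLamSum_eq _ _ _ _ _ hc, hh0]

include hx hh hg hh0 in
theorem tensorHomotopy_update_block (s : Finset (Edge G)) (c : Comp s) (z : B) :
    tensorHomotopy 𝒜 f g h (PiTensorProduct.tprod R
        (Function.update (block k 𝒜 h (fun v => g (a v)) s) c z)) =
      sgn R (∑ v, if rep s v < c.1 then (k v : ZMod 2) + offset (rep s) v else 0) •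
        PiTensorProduct.tprod R fun i =>
          if i < c then g (f (block k 𝒜 h (fun v => g (a v)) s i))
          else if i = c then h z else block k 𝒜 h (fun v => g (a v)) s i := by
  rw [tensorHomotopy_tprod 𝒜 f g h (fun i => cellDeg k s i.1) _ c,
    ← sum_comp_ite_cellDeg k s fun v => v < c.1]
  · congr 2
    funext i
    rcases lt_trichotomy i c with hi | rfl | hi
    · simp [hi, Function.update_of_ne hi.ne]
    · simp
    · simp [hi.not_gt, hi.ne']
  · intro i hi
    rw [Function.update_of_ne hi]
    exact block_mem k 𝒜 h _ hx hh s i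
  · intro i hi
    rw [Function.update_of_ne hi]
    exact h_block k 𝒜 g h a hg hh0 s i

include hx hh hcomm fg hg fh hh0 in
/-- If `c` is the first component of `[G : s]` with at least two vertices, then only the edges in
`c` contribute to a step of the iteration at `s`: if the new block lies to the right of `c`, then
`f h = 0` kills the term. -/
theorem tensorHomotopy_koszulMul (hG : G.IsAcyclic) {s : Finset (Edge G)} {c : Comp s}
    (hc : 2 ≤ (cell s c.1).card) (hmin : ∀ c' : Comp s, c' < c → (cell s c'.1).card < 2)
    {α : Edge G} (hα : α ∈ s) :
    ((-1 : R) ^ s.card) • tensorHomotopy 𝒜 f g h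
      (((edgeSign α (s.erase α) : ℤ) : R) • koszulMul 𝒜
          (fun c : Comp (s.erase α) => compOf s c.1) (forestCoeff k R (s.erase α) •
            PiTensorProduct.tprod R (block k 𝒜 h (fun v => g (a v)) (s.erase α)))) =
      if α.tail ∈ cell s c.1 then forestCoeff k R s • PiTensorProduct.tprod R
        (Function.update (block k 𝒜 h (fun v => g (a v)) s) c
          (h (cutProd 𝒜 h (edgeRel G) (fun v => g (a v)) k (cell (s.erase α) α.tail)
            (cell (s.erase α) α.head)))) else 0 := by
  have hiff : α.tail ∈ cell s c.1 ↔ compOf s α.tail = c := by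
    rw [mem_cell_iff_rep, rep_coe, Subtype.ext_iff]
    rfl
  have hr : rep s α.tail = (compOf s α.tail).1 := rfl
  rw [koszulMul_block k 𝒜 h _ hx hh hcomm hG hα, map_smul,
    tensorHomotopy_update_block k 𝒜 f g h a hx hh hg hh0, hr]
  generalize (∑ v, if rep s v < (compOf s α.tail).1 then
    (k v : ZMod 2) + offset (rep s) v else 0) = b
  by_cases hc' : compOf s α.tail = c
  · rw [if_pos (hiff.2 hc'), hc']
    have e1 : (fun i => if i < c then g (f (block k 𝒜 h (fun v => g (a v)) s i))
        else if i = c then h (cutProd 𝒜 h (edgeRel G) (fun v => g (a v)) k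
          (cell (s.erase α) α.tail) (cell (s.erase α) α.head))
        else block k 𝒜 h (fun v => g (a v)) s i) =
        Function.update (block k 𝒜 h (fun v => g (a v)) s) c
          (h (cutProd 𝒜 h (edgeRel G) (fun v => g (a v)) k (cell (s.erase α) α.tail)
            (cell (s.erase α) α.head))) := by
      funext i
      rcases lt_trichotomy i c with hi | rfl | hi
      · rw [if_pos hi, Function.update_of_ne hi.ne,
          block_of_card_lt_two k 𝒜 h _ (hmin i hi), map_neg, map_neg, fg]
      · simp
      · rw [if_neg hi.not_gt, if_neg hi.ne', Function.update_of_ne hi.ne']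
    have e2 : (-1 : R) ^ s.card * (sgn R (s.card + b) * forestCoeff k R s) * sgn R b =
        forestCoeff k R s := by
      rw [← sgn_natCast, sgn_add]
      calc _ = (sgn R (s.card : ZMod 2) * sgn R (s.card : ZMod 2)) * (sgn R b * sgn R b) *
              forestCoeff k R s := by ring
        _ = _ := by rw [sgn_mul_self, sgn_mul_self, one_mul, one_mul]
    rw [e1, smul_smul, smul_smul, e2]
  · have hlt : c < compOf s α.tail := by
      refine lt_of_le_of_ne (not_lt.1 fun H => ?_) (Ne.symm hc')
      have := hmin _ H
      have := two_le_card_cell hα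
      omega
    rw [if_neg fun H => hc' (hiff.1 H), (PiTensorProduct.tprod R).map_coord_zero c, smul_zero,
      smul_zero, smul_zero]
    rw [if_pos hlt, block, hLamSum_eq _ _ _ _ _ hc, fh, map_zero]

theorem exists_first_comp {s : Finset (Edge G)} (hs : s.Nonempty) :
    ∃ c : Comp s, 2 ≤ (cell s c.1).card ∧ ∀ c' : Comp s, c' < c → (cell s c'.1).card < 2 := by
  obtain ⟨β, hβ⟩ := hs
  obtain ⟨c, hc, hmin⟩ := (Finset.univ.filter fun c : Comp s => 2 ≤ (cell s c.1).card).exists_min_image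
    id ⟨compOf s β.tail, Finset.mem_filter.2 ⟨Finset.mem_univ _, two_le_card_cell hβ⟩⟩
  refine ⟨c, (Finset.mem_filter.1 hc).2, fun c' hc' => ?_⟩
  by_contra hcon
  exact (hmin c' (Finset.mem_filter.2 ⟨Finset.mem_univ c', not_lt.1 hcon⟩)).not_gt hc'

include hx hh hcomm fg hg fh hh0 in
/-- One step of the iteration at the spanning forest `s`. -/
theorem tensorHomotopy_sum_koszulMul (hG : G.IsAcyclic) {s : Finset (Edge G)}
    (hs : s.Nonempty) :
    ((-1 : R) ^ s.card) • tensorHomotopy 𝒜 f g h (∑ α ∈ s,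
        ((edgeSign α (s.erase α) : ℤ) : R) • koszulMul 𝒜
          (fun c : Comp (s.erase α) => compOf s c.1) (forestCoeff k R (s.erase α) •
            PiTensorProduct.tprod R (block k 𝒜 h (fun v => g (a v)) (s.erase α)))) =
      forestCoeff k R s • PiTensorProduct.tprod R (block k 𝒜 h (fun v => g (a v)) s) := by
  obtain ⟨c₀, hc₀, hmin⟩ := exists_first_comp hs
  have e := MultilinearMap.map_update_sum (PiTensorProduct.tprod R)
    (s.filter fun α => α.tail ∈ cell s c₀.1) c₀
    (fun α => h (cutProd 𝒜 h (edgeRel G) (fun v => g (a v)) k (cell (s.erase α) α.tail)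
      (cell (s.erase α) α.head))) (block k 𝒜 h (fun v => g (a v)) s)
  rw [← map_sum, ← lamSum_cell 𝒜 h _ k hx hh hcomm hG,
    ← hLamSum_eq 𝒜 h (edgeRel G) _ k hc₀] at e
  have e' : Function.update (block k 𝒜 h (fun v => g (a v)) s) c₀
      (hLamSum 𝒜 h (edgeRel G) (fun v => g (a v)) k (cell s c₀.1)) =
      block k 𝒜 h (fun v => g (a v)) s := Function.update_eq_self c₀ _
  rw [e'] at e
  rw [map_sum, Finset.smul_sum]
  refine (Finset.sum_congr rfl fun α hα =>
    tensorHomotopy_koszulMul k 𝒜 f g h a hx hh hcomm fg hg fh hh0 hG hc₀ hmin hα).trans ?_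
  rw [← Finset.sum_filter, ← Finset.smul_sum, ← e]

omit [AddCommGroup A] [Module R A] in
theorem graphDelta_apply (y : GraphComplex R G B) (s : Finset (Edge G)) :
    graphDelta G 𝒜 y s = ∑ α ∈ s, ((edgeSign α (s.erase α) : ℤ) : R) •
      koszulMul 𝒜 (fun c : Comp (s.erase α) => compOf s c.1) (y (s.erase α)) := by
  simp [graphDelta]

theorem graphHomotopy_apply (y : GraphComplex R G B) (s : Finset (Edge G)) :
    graphHomotopy G 𝒜 f g h y s = ((-1 : R) ^ s.card) • tensorHomotopy 𝒜 f g h (y s) := rfl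

/-- Each `s - α` has one edge fewer than `s`, and scalars can be pulled out of the sum over `α`. -/
theorem sum_koszulMul_ite (x : Fin n → B) {m : ℕ} {s : Finset (Edge G)} (hs : s.card = m + 1)
    (c : R) :
    (∑ α ∈ s, ((edgeSign α (s.erase α) : ℤ) : R) • koszulMul 𝒜
      (fun c : Comp (s.erase α) => compOf s c.1) (if (s.erase α).card = m then
        (c * forestCoeff k R (s.erase α)) •
          PiTensorProduct.tprod R (block k 𝒜 h x (s.erase α)) else 0)) =
      c • ∑ α ∈ s, ((edgeSign α (s.erase α) : ℤ) : R) • koszulMul 𝒜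
        (fun c : Comp (s.erase α) => compOf s c.1) (forestCoeff k R (s.erase α) •
          PiTensorProduct.tprod R (block k 𝒜 h x (s.erase α))) := by
  rw [Finset.smul_sum]
  refine Finset.sum_congr rfl fun α hα => ?_
  have he : (s.erase α).card = m := by
    rw [Finset.card_erase_of_mem hα]; omega
  simp only [if_pos he, map_smul, smul_smul]
  congr 1
  ring

theorem forestExp_id (k : Fin n → ℤ) : forestExp k (rep (∅ : Finset (Edge G))) = 0 := by
  refine Finset.sum_eq_zero fun v _ => Finset.sum_eq_zero fun w _ => ?_
  rw [pairExp, rep_empty, rep_empty, offset, rep_empty]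
  rcases lt_trichotomy v w with H | rfl | H
  · simp [H, H.ne, H.not_gt]
  · simp
  · simp [H.not_gt]

include hx hh hcomm fg hg fh hh0 in
/-- The iterates `(h δ)^m` on `e_∅ · g^{⊗ n} (a)`: at a spanning forest with `m` edges the
coefficient is, up to sign, the tensor product of the operations on the components. -/
theorem iterate_homotopy_delta (hG : G.IsAcyclic) (m : ℕ) (s : Finset (Edge G)) :
    ((graphHomotopy G 𝒜 f g h ∘ₗ graphDelta G 𝒜 : Module.End R (GraphComplex R G B)) ^ m)
        (graphMap G g (eMul ∅ (PiTensorProduct.tprod R fun c => a c.1))) s =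
      if s.card = m then ((-1 : R) ^ n * forestCoeff k R s) •
        PiTensorProduct.tprod R (block k 𝒜 h (fun v => g (a v)) s) else 0 := by
  induction m generalizing s with
  | zero =>
    rw [pow_zero, Module.End.one_apply, graphMap, LinearMap.pi_apply, LinearMap.comp_apply,
      LinearMap.proj_apply, eMul]
    by_cases hs : s = ∅
    · subst hs
      have hb : block k 𝒜 h (fun v => g (a v)) (∅ : Finset (Edge G)) =
          fun c => (-1 : R) • g (a c.1) := by
        funext c
        rw [block_of_card_lt_two, neg_one_smul]
        rw [cell_empty, Finset.card_singleton]
        norm_num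
      have hcard : Fintype.card (Comp (∅ : Finset (Edge G))) = n := by
        conv_rhs => rw [← Fintype.card_fin n]
        refine Fintype.card_of_bijective (f := Subtype.val)
          ⟨Subtype.val_injective, fun v => ⟨compOf ∅ v, rep_empty v⟩⟩
      have hp : (-1 : R) ^ n * (-1 : R) ^ n = 1 := by
        rw [← mul_pow, neg_one_mul, neg_neg, one_pow]
      rw [Pi.single_eq_same, PiTensorProduct.map_tprod, Finset.card_empty, if_pos rfl, hb,
        MultilinearMap.map_smul_univ, Finset.prod_const, Finset.card_univ, hcard, smul_smul,
        forestCoeff, forestExp_id, forestSign_empty, Finset.card_empty]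
      simp [hp]
    · rw [Pi.single_eq_of_ne hs, map_zero, if_neg]
      rwa [Finset.card_eq_zero]
  | succ m ih =>
    rw [pow_succ', Module.End.mul_apply, LinearMap.comp_apply, graphHomotopy_apply,
      graphDelta_apply]
    simp only [ih]
    by_cases hs : s.card = m + 1
    · have hne : s.Nonempty := by
        rw [← Finset.card_pos]; omega
      rw [if_pos hs, mul_smul, ← tensorHomotopy_sum_koszulMul k 𝒜 f g h a hx hh hcomm fg hg fh hh0
        hG hne, sum_koszulMul_ite k 𝒜 h _ hs, map_smul, smul_comm]
    · rw [if_neg hs, Finset.sum_eq_zero, map_zero, smul_zero]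
      intro α hα
      have he : (s.erase α).card ≠ m := by
        have := Finset.card_pos.2 ⟨α, hα⟩
        rw [Finset.card_erase_of_mem hα]
        omega
      rw [if_neg he, map_zero, smul_zero]

end Iteration

/-! ### Linear extensions as permutations, and the top coefficient -/

section Permutations

theorem listInv_ofFn {V : Type*} [LinearOrder V] (k : V → ℤ) {m : ℕ} (u : Fin m → V) :
    listInv k (List.ofFn u) = ∑ i, ∑ j, if i < j ∧ u j < u i then
      1 + (k (u i) : ZMod 2) * (k (u j) : ZMod 2) else 0 := by
  induction m with
  | zero => simp [listInv]
  | succ m ih =>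
    rw [List.ofFn_succ, listInv, ih, List.map_ofFn, List.sum_ofFn, Fin.sum_univ_succ,
      Fin.sum_univ_succ]
    simp [Fin.sum_univ_succ]

variable {n : ℕ}

theorem sign_eq_sgn (R : Type*) [CommRing R] (σ : Equiv.Perm (Fin n)) :
    ((Equiv.Perm.sign σ : ℤ) : R) =
      sgn R (∑ i, ∑ j, if i < j ∧ σ j < σ i then 1 else 0) := by
  rw [Equiv.Perm.sign_eq_prod_prod_Ioi, Units.coe_prod, Int.cast_prod, sgn_sum]
  refine Finset.prod_congr rfl fun i _ => ?_
  rw [Units.coe_prod, Int.cast_prod, sgn_sum, ← Finset.filter_lt_eq_Ioi, Finset.prod_filter]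
  refine Finset.prod_congr rfl fun j _ => ?_
  by_cases hij : i < j
  · have hne : σ i ≠ σ j := fun H => hij.ne (σ.injective H)
    rcases lt_or_gt_of_ne hne with H | H
    · simp [hij, H, H.not_gt]
    · simp [hij, H, H.not_gt]
  · simp [hij]

theorem sgn_listInv_ofFn (R : Type*) [CommRing R] (k : Fin n → ℤ) (σ : Equiv.Perm (Fin n)) :
    sgn R (listInv k (List.ofFn σ)) =
      (((Equiv.Perm.sign σ * koszulSign (⇑σ.symm) k : ℤˣ) : ℤ) : R) := by
  rw [Units.val_mul, Int.cast_mul, koszulSign_eq_sgn, ← Equiv.Perm.sign_symm, sign_eq_sgn,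
    ← sgn_add, ← Finset.sum_add_distrib, listInv_ofFn]
  congr 1
  rw [← Equiv.sum_comp σ.symm, Finset.sum_congr rfl fun v _ => (Equiv.sum_comp σ.symm _).symm,
    Finset.sum_comm]
  refine Finset.sum_congr rfl fun v _ => ?_
  rw [← Finset.sum_add_distrib]
  refine Finset.sum_congr rfl fun w _ => ?_
  simp only [Equiv.apply_symm_apply, and_comm (a := v < w), mul_comm (k v : ZMod 2)]
  split_ifs <;> simp

theorem sum_linExts_univ {M : Type*} [AddCommMonoid M] (G : SimpleGraph (Fin n))
    (F : List (Fin n) → M) :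
    ∑ l ∈ linExts (edgeRel G) Finset.univ, F l =
      ∑ σ ∈ linearExtensions G, F (List.ofFn σ) := by
  symm
  have hiff : ∀ σ : Equiv.Perm (Fin n), σ ∈ linearExtensions G ↔
      (List.ofFn σ).Pairwise fun v w => ¬ edgeRel G w v := by
    intro σ
    rw [linearExtensions, Finset.mem_filter, List.pairwise_ofFn]
    simp only [Finset.mem_univ, true_and]
    constructor
    · intro H i j hij hr
      obtain ⟨α, h1, h2⟩ := edgeRel_iff.1 hr
      have := H α
      rw [h1, h2, Equiv.symm_apply_apply, Equiv.symm_apply_apply] at this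
      exact lt_asymm hij this
    · intro H α
      by_contra hcon
      have hne : σ.symm α.head ≠ σ.symm α.tail := fun K =>
        α.tail_lt_head.ne' (σ.symm.injective K)
      refine H (lt_of_le_of_ne (not_lt.1 hcon) hne) ?_
      rw [Equiv.apply_symm_apply, Equiv.apply_symm_apply]
      exact edgeRel_iff.2 ⟨α, rfl, rfl⟩
  refine Finset.sum_bij (fun σ _ => List.ofFn σ) ?_ ?_ ?_ ?_
  · intro σ hσ
    rw [mem_linExts]
    refine ⟨?_, (hiff σ).1 hσ⟩
    rw [Multiset.Nodup.ext (Multiset.coe_nodup.2 (List.nodup_ofFn.2 σ.injective))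
      Finset.univ.nodup]
    intro v
    simp only [Multiset.mem_coe, List.mem_ofFn, Finset.mem_val, Finset.mem_univ, iff_true]
    exact σ.surjective v
  · intro σ _ τ _ H
    exact Equiv.ext fun i => congrFun (List.ofFn_injective H) i
  · intro l hl
    have hlen := length_of_mem_linExts hl
    rw [Finset.card_univ, Fintype.card_fin] at hlen
    have hnd : l.Nodup := by
      rw [← Multiset.coe_nodup, (mem_linExts.1 hl).1]
      exact Finset.univ.nodup
    have hinj : Function.Injective fun i : Fin n => l[(i : ℕ)]'(hlen.symm ▸ i.2) := by
      intro i j hij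
      exact Fin.ext ((List.Nodup.getElem_inj_iff hnd).1 hij)
    have hof : List.ofFn (Equiv.ofBijective _ (Finite.injective_iff_bijective.1 hinj)) = l :=
      List.ext_getElem (by simp [hlen]) fun i h1 h2 => by simp
    refine ⟨Equiv.ofBijective _ (Finite.injective_iff_bijective.1 hinj), ?_, hof⟩
    rw [hiff, hof]
    exact (mem_linExts.1 hl).2
  · intro σ _
    rfl

end Permutations

section Top

variable {n : ℕ} {G : SimpleGraph (Fin n)} (k : Fin n → ℤ)

/-- For a connected graph, only the pairs inside the single block contribute to the exponent. -/
theorem forestExp_univ (hG : G.Connected) :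
    forestExp k (rep (Finset.univ : Finset (Edge G))) = ((n * (n - 1) / 2 : ℕ) : ZMod 2) := by
  have hrep : ∀ v w, rep (Finset.univ : Finset (Edge G)) v = rep Finset.univ w := fun v w =>
    rep_eq_rep_iff.2 (linked_of_reachable (hG.preconnected v w))
  have e : ∀ v w, pairExp k (rep (Finset.univ : Finset (Edge G))) v w =
      if v < w then 1 else 0 := by
    intro v w
    rw [pairExp, if_pos (hrep v w), if_neg (hrep v w).not_lt, add_zero]
  have h2 : ∀ w : Fin n, (Finset.univ.filter fun v => v < w).card = (w : ℕ) := by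
    intro w
    rw [Finset.filter_gt_eq_Iio, Fin.card_Iio]
  rw [forestExp, Finset.sum_congr rfl fun v _ => Finset.sum_congr rfl fun w _ => e v w,
    Finset.sum_comm, ← Finset.sum_range_id, ← Fin.sum_univ_eq_sum_range (fun i => i)]
  push_cast
  refine Finset.sum_congr rfl fun w _ => ?_
  rw [Finset.sum_boole, h2]

variable {R : Type*} [CommRing R] {B : Type*} [Ring B] [Algebra R B]
  (𝒜 : ℤ → Submodule R B) [GradedAlgebra 𝒜] {A : Type*} [AddCommGroup A] [Module R A]
  (f : B →ₗ[R] A) (g : A →ₗ[R] B) (h : B →ₗ[R] B) (a : Fin n → A)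

theorem pow_delta_homotopy_delta (m : ℕ) (y : GraphComplex R G B) :
    ((graphDelta G 𝒜 ∘ₗ graphHomotopy G 𝒜 f g h : Module.End R (GraphComplex R G B)) ^ m)
        (graphDelta G 𝒜 y) =
      graphDelta G 𝒜 (((graphHomotopy G 𝒜 f g h ∘ₗ graphDelta G 𝒜 :
        Module.End R (GraphComplex R G B)) ^ m) y) := by
  induction m generalizing y with
  | zero => rfl
  | succ m ih =>
    rw [pow_succ, pow_succ, Module.End.mul_apply, Module.End.mul_apply, LinearMap.comp_apply,
      LinearMap.comp_apply, ih]

variable (R) in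
theorem tprod_sum_smul_of_subsingleton {ι M T : Type*} [Subsingleton ι] [AddCommGroup M]
    [Module R M] (i₀ : ι) (t : Finset T) (c : T → R) (z : T → M) :
    PiTensorProduct.tprod R (fun _ : ι => ∑ j ∈ t, c j • z j) =
      ∑ j ∈ t, c j • PiTensorProduct.tprod R fun _ : ι => z j := by
  simp only [← PiTensorProduct.subsingletonEquiv_symm_apply' (R := R) i₀, map_sum, map_smul]

variable (hx : ∀ v, g (a v) ∈ 𝒜 (k v)) (hh : ∀ i, ∀ y ∈ 𝒜 i, h y ∈ 𝒜 (i - 1))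
  (hcomm : ∀ i j, ∀ y ∈ 𝒜 i, ∀ z ∈ 𝒜 j, y * z = (i * j).negOnePow • (z * y))

include hx hh hcomm in
/-- The coefficient of `e_t` for the whole tree `t`, before `f` is applied. -/
theorem sum_koszulMul_univ (hG : G.IsTree) :
    (∑ α : Edge G, ((edgeSign α (Finset.univ.erase α) : ℤ) : R) • koszulMul 𝒜
      (fun c : Comp (Finset.univ.erase α) => compOf Finset.univ c.1)
        (forestCoeff k R (Finset.univ.erase α) •
          PiTensorProduct.tprod R (block k 𝒜 h (fun v => g (a v)) (Finset.univ.erase α)))) =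
      ((-1 : R) ^ (n - 1) * forestCoeff k R (Finset.univ : Finset (Edge G))) •
        PiTensorProduct.tprod R fun _ : Comp (Finset.univ : Finset (Edge G)) =>
          lamSum 𝒜 h (edgeRel G) (fun v => g (a v)) k Finset.univ := by
  have hrep : ∀ v w, rep (Finset.univ : Finset (Edge G)) v = rep Finset.univ w := fun v w =>
    rep_eq_rep_iff.2 (linked_of_reachable (hG.connected.preconnected v w))
  have hss : Subsingleton (Comp (Finset.univ : Finset (Edge G))) := ⟨fun c c' =>
    Subtype.ext ((rep_coe c).symm.trans ((hrep _ _).trans (rep_coe c')))⟩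
  obtain ⟨v⟩ := hG.connected.nonempty
  have hcard : (Finset.univ : Finset (Edge G)).card = n - 1 := by
    have := card_edge hG
    rw [Finset.card_univ]
    omega
  have hcell : cell (Finset.univ : Finset (Edge G)) v = Finset.univ := by
    ext w
    rw [mem_cell_iff_rep]
    exact iff_of_true (hrep w v) (Finset.mem_univ w)
  have hlam := lamSum_cell 𝒜 h _ k hx hh hcomm hG.isAcyclic Finset.univ v
  rw [hcell] at hlam
  have h1 := tprod_sum_smul_of_subsingleton R (compOf (Finset.univ : Finset (Edge G)) v)
    (Finset.univ.filter fun α : Edge G => α.tail ∈ Finset.univ) (fun _ => 1)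
    (fun α => cutProd 𝒜 h (edgeRel G) (fun v => g (a v)) k (cell (Finset.univ.erase α) α.tail)
      (cell (Finset.univ.erase α) α.head))
  simp only [one_smul] at h1
  rw [hlam, h1, Finset.smul_sum]
  refine Finset.sum_congr (by simp) fun α _ => ?_
  rw [koszulMul_block k 𝒜 h _ hx hh hcomm hG.isAcyclic (Finset.mem_univ α)]
  congr 1
  · simp only [hrep _ α.tail, lt_irrefl, if_false, Finset.sum_const_zero, add_zero, hcard,
      sgn_natCast]
  · congr 1
    funext c
    rw [Subsingleton.elim c (compOf Finset.univ α.tail), Function.update_self]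

end Top

end GraphMassey

end

open GraphMassey in
theorem proposition3 {R : Type*} [CommRing R]
    {B : Type*} [Ring B] [Algebra R B] (𝒜 : ℤ → Submodule R B) [GradedAlgebra 𝒜]
    (d : B →ₗ[R] B) (h𝒜 : IsCDGA 𝒜 d)
    {A : Type*} [AddCommGroup A] [Module R A] (ℋ : ℤ → Submodule R A)
    [DirectSum.Decomposition ℋ]
    (f : B →ₗ[R] A) (g : A →ₗ[R] B) (h : B →ₗ[R] B)
    (hred : IsReduction 𝒜 d ℋ 0 f g h)
    {n : ℕ} (hn : 2 ≤ n) (G : SimpleGraph (Fin n)) (hG : G.IsTree)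
    (k : Fin n → ℤ) (a : Fin n → A) (ha : ∀ i, a i ∈ ℋ (k i)) :
    perturbOp G 𝒜 f g h (n - 1)
        (eMul ∅ (PiTensorProduct.tprod R fun c => a c.1)) =
      ((-1 : R) ^ (n * (n - 1) / 2) * (treeSign G : R)) •
        ∑ σ ∈ linearExtensions G,
          (((Equiv.Perm.sign σ * koszulSign (⇑σ.symm) k : ℤˣ) : ℤ) : R) •
            eMul Finset.univ
              (PiTensorProduct.tprod R fun _ => mProd 𝒜 h f g fun i => a (σ i)) := by
  have hx : ∀ v, g (a v) ∈ 𝒜 (k v) := fun v => hred.g_mem _ _ (ha v)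
  have hcard : Fintype.card (Edge G) = n - 1 := by
    have := card_edge hG
    omega
  have hZ := iterate_homotopy_delta k 𝒜 f g h a hx hred.h_mem h𝒜.comm hred.fg hred.hg hred.fh
    hred.hh hG.isAcyclic (n - 1 - 1)
  obtain ⟨v⟩ := hG.connected.nonempty
  have hss : Subsingleton (Comp (Finset.univ : Finset (Edge G))) := ⟨fun c c' =>
    Subtype.ext ((rep_coe c).symm.trans ((rep_eq_rep_iff.2
      (linked_of_reachable (hG.connected.preconnected _ _))).trans (rep_coe c')))⟩
  -- the right-hand side in terms of the sum over linear extensions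
  have hR : (PiTensorProduct.tprod R fun _ : Comp (Finset.univ : Finset (Edge G)) =>
      f (lamSum 𝒜 h (edgeRel G) (fun v => g (a v)) k Finset.univ)) =
      ∑ σ ∈ linearExtensions G,
        (((Equiv.Perm.sign σ * koszulSign (⇑σ.symm) k : ℤˣ) : ℤ) : R) •
          PiTensorProduct.tprod R fun _ => mProd 𝒜 h f g fun i => a (σ i) := by
    rw [← tprod_sum_smul_of_subsingleton R (compOf (Finset.univ : Finset (Edge G)) v), lamSum,
      map_sum, sum_linExts_univ]
    congr 1
    funext _
    refine Finset.sum_congr rfl fun σ _ => ?_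
    rw [map_smul, sgn_listInv_ofFn, List.map_ofFn]
    rfl
  have hS : (∑ σ ∈ linearExtensions G,
      (((Equiv.Perm.sign σ * koszulSign (⇑σ.symm) k : ℤˣ) : ℤ) : R) •
        eMul (Finset.univ : Finset (Edge G))
          (PiTensorProduct.tprod R fun _ => mProd 𝒜 h f g fun i => a (σ i))) =
      eMul Finset.univ (PiTensorProduct.tprod R fun _ : Comp (Finset.univ : Finset (Edge G)) =>
        f (lamSum 𝒜 h (edgeRel G) (fun v => g (a v)) k Finset.univ)) := by
    rw [hR]
    simp only [eMul, ← LinearMap.coe_single (R := R), map_sum, map_smul]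
  rw [hS, perturbOp, LinearMap.smul_apply, LinearMap.comp_apply, LinearMap.comp_apply,
    LinearMap.comp_apply, pow_delta_homotopy_delta]
  funext s
  rw [Pi.smul_apply, Pi.smul_apply]
  have hgm : ∀ y : GraphComplex R G B,
      graphMap G f y s = PiTensorProduct.map (fun _ => f) (y s) := fun _ => rfl
  rw [hgm, graphDelta_apply]
  simp only [hZ]
  by_cases hs : s = Finset.univ
  · subst hs
    have hc : (Finset.univ : Finset (Edge G)).card = n - 1 - 1 + 1 := by
      rw [Finset.card_univ, hcard]
      omega
    rw [sum_koszulMul_ite k 𝒜 h _ hc, sum_koszulMul_univ k 𝒜 g h a hx hred.h_mem h𝒜.comm hG, map_smul, map_smul,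
      PiTensorProduct.map_tprod, eMul, Pi.single_eq_same, smul_smul, smul_smul, forestCoeff,
      forestExp_univ k hG.connected, forestSign_univ hG, Finset.card_univ, hcard, sgn_add,
      sgn_natCast, sgn_natCast]
    congr 1
    obtain ⟨m, rfl⟩ : ∃ m, n = m + 2 := ⟨n - 2, by omega⟩
    simp only [show m + 2 - 1 = m + 1 by omega, Nat.add_sub_cancel]
    have h1 : (-1 : R) ^ m * (-1 : R) ^ m = 1 := by
      rw [← mul_pow, neg_one_mul, neg_neg, one_pow]
    have h2 : (-1 : R) ^ (m + 2) = (-1) ^ m := by rw [pow_add, neg_one_sq, mul_one]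
    have h3 : (-1 : R) ^ (m + 1) * (-1 : R) ^ (m + 1) = 1 := by
      rw [← mul_pow, neg_one_mul, neg_neg, one_pow]
    rw [h2]
    calc _ = ((-1 : R) ^ m * (-1 : R) ^ m) * ((-1 : R) ^ (m + 1) * (-1 : R) ^ (m + 1)) *
          ((-1 : R) ^ ((m + 2) * (m + 1) / 2) * (treeSign G : R)) := by ring
      _ = _ := by rw [h1, h3, one_mul, one_mul]
  · rw [eMul, Pi.single_eq_of_ne hs, smul_zero, Finset.sum_eq_zero, map_zero, smul_zero]
    intro α hα
    have he : (s.erase α).card ≠ n - 1 - 1 := by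
      have h1 := Finset.card_lt_card (Finset.ssubset_univ_iff.2 hs)
      have h2 := Finset.card_pos.2 ⟨α, hα⟩
      rw [Finset.card_univ, hcard] at h1
      rw [Finset.card_erase_of_mem hα]
      omega
    rw [if_neg he, map_zero, smul_zero]
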